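/- Let $W_2=\mathrm{Tot}(\mathcal O_{\mathbb P^1}(-2)\oplus\mathcal O_{\mathbb P^1}(0))$ be the complex threefold glued from $U=\mathbb C^3_{(z,u_1,u_2)}$ and $V=\mathbb C^3_{(\xi,v_1,v_2)}$ along $\{z\neq0\}\cong\{\xi\ne 0\}$ by $(\xi,v_1,v_2)=(z^{-1},z^2u_1,u_2)$, and let $H^1(W_2,TW_2)=\Gamma(U\cap V,TW_2)/(\Gamma(U,TW_2)+\Gamma(V,TW_2))$ be the first Čech cohomology of the tangent sheaf for the cover $\{U,V\}$. Let $T$ be the vector space of sequences $t=(t_j)_{j\ge0}$ in $\mathbb C$ such that $\sum_j t_jw^j$ converges for all $w\in\mathbb C$. A deformation of a complex manifold $X$ over a complex normed space $E$ is a Hausdorff complex manifold $\mathcal M$ with a surjective holomorphic submersion $\pi\colon\mathcal M\to E$ and a biholomorphism $X\cong\pi^{-1}(0)$, such that there is a $C^\infty$ diffeomorphism $\mathcal M\cong X\times E$ over $E$ that restricts to the given identification $X\cong X\times\{0\}$ on the central fibre. Then $W_2$ has an infinite-dimensional family of deformations. Precisely: 1. For the holomorphic tangent sheaf, $H^1(W_2,TW_2)$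 is generated by the cocycles $\sigma_j=(0,z^{-1}u_2^j,0)$, $j\ge0$ (components in the coordinates of $U$), in the sense of convergent series: the map $\Theta\colon T\to H^1(W_2,TW_2)$ sending $t$ to the class of $\left(0,z^{-1}\sum_{j\ge0}t_ju_2^j,0\right)$ is an isomorphism of vector spaces. In particular $H^1(W_2,TW_2)$ is infinite-dimensional. For the algebraic tangent sheaf (polynomial vector fields on $U$ and $V$, Laurent polynomial in $z$ on $U\cap V$) the classes of the $\sigma_j$ form a vector space basis of $H^1(W_2,TW_2)$. 2. Let $E$ be a complex normed space and let $L\colon E\to T$, $e\mapsto(t_j(e))_j$, be a linear map such that $(e,w)\mapsto\sum_jt_j(e)w^j$ is holomorphic on $E\times\mathbb C$. Glue $U\times E$ and $V\times E$ over $\{z\ne0\}$ by $$(\xi,v_1,v_2,e)=\Bigl(z^{-1},\;z^2u_1+\sum_{j\ge0}t_j(e)\,z\,u_2^j,\;u_2,\;e\Bigr).$$ The resulting space, with its projection to $E$, is a deformation of $W_2$ over $E$, whose Kodaira–Spencer map at $0$ is $e\mapsto\Theta(L(e))$. 3. The holomorphy condition in 2 holds for every linear map $L\colon E\to T$ with $E$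 finite-dimensional. It also holds for some injective linear map $L\colon E\to T$ with $E$ an infinite-dimensional Banach space whose image contains all finite sequences $(t_0,t_1,\dots,t_n,0,0,\dots)$. For such an $L$, 2 gives a deformation over an infinite-dimensional base with injective Kodaira–Spencer map. 4. Every class $c\in H^1(W_2,TW_2)$ (holomorphic) is integrable: it is the Kodaira–Spencer class of a one-parameter deformation of $W_2$ over $\mathbb C$ of the form in 2. -/

import Mathlib

open Set Filter Topology
open scoped Manifold ContDiff

noncomputable section

/-! ### Gluing two copies of a model space along a partial homeomorphism -/

namespace Gluing

variable {F : Type*} [TopologicalSpace F]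

/-- The equivalence relation on the disjoint union of two copies `U`, `V` of `F` that identifies
`p ∈ g.source ⊆ U` with `g p ∈ g.target ⊆ V`. -/
def Rel (g : OpenPartialHomeomorph F F) : F ⊕ F → F ⊕ F → Prop
  | .inl p, .inl q => p = q
  | .inr p, .inr q => p = q
  | .inl p, .inr q => p ∈ g.source ∧ g p = q
  | .inr q, .inl p => p ∈ g.source ∧ g p = q

/-- The gluing relation as a setoid. -/
def setoid (g : OpenPartialHomeomorph F F) : Setoid (F ⊕ F) where
  r := Rel g
  iseqv :=
    { refl := by rintro (p | p) <;> rfl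
      symm := by
        rintro (p | p) (q | q) h
        · exact Eq.symm h
        · exact h
        · exact h
        · exact Eq.symm h
      trans := by
        rintro (p | p) (q | q) (r | r) h₁ h₂
        · exact Eq.trans h₁ h₂
        · obtain rfl : p = q := h₁
          exact h₂
        · exact g.injOn h₁.1 h₂.1 (h₁.2.trans h₂.2.symm)
        · exact ⟨h₁.1, h₁.2.trans h₂⟩
        · obtain rfl : q = r := h₂
          exact h₁
        · exact h₁.2.symm.trans h₂.2
        · exact ⟨h₂.1, h₂.2.trans (Eq.symm h₁)⟩
        · exact Eq.trans h₁ h₂ }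

end Gluing

/-- The space `U ∪ V` glued from two copies `U`, `V` of `F` along the transition map `g`. -/
def Glued {F : Type*} [TopologicalSpace F] (g : OpenPartialHomeomorph F F) : Type _ :=
  Quotient (Gluing.setoid g)

namespace Glued

variable {F : Type*} [TopologicalSpace F] {g : OpenPartialHomeomorph F F}

instance : TopologicalSpace (Glued g) :=
  inferInstanceAs (TopologicalSpace (Quotient (Gluing.setoid g)))

/-- The inclusion of the first copy `U`. -/
def inU (p : F) : Glued g := Quotient.mk (Gluing.setoid g) (.inl p)

/-- The inclusion of the second copy `V`. -/
def inV (p : F) : Glued g := Quotient.mk (Gluing.setoid g) (.inr p)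

/-- Maps out of a glued space: a pair of maps which agree on the overlap. -/
def lift {Y : Type*} (a b : F → Y) (h : ∀ p ∈ g.source, a p = b (g p)) : Glued g → Y :=
  Quotient.lift (s := Gluing.setoid g) (Sum.elim a b) (by
    rintro (p | p) (q | q) hpq
    · exact congrArg a hpq
    · obtain ⟨hp, rfl⟩ := hpq
      exact h p hp
    · obtain ⟨hp, rfl⟩ := hpq
      exact (h q hp).symm
    · exact congrArg b hpq)

theorem inU_eq_inV_iff {p q : F} : (inU p : Glued g) = inV q ↔ p ∈ g.source ∧ g p = q :=
  Quotient.eq (r := Gluing.setoid g)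

theorem inU_injective : Function.Injective (inU : F → Glued g) :=
  fun _ _ h => (Quotient.eq (r := Gluing.setoid g)).1 h

theorem inV_injective : Function.Injective (inV : F → Glued g) :=
  fun _ _ h => (Quotient.eq (r := Gluing.setoid g)).1 h

theorem exists_rep (x : Glued g) : (∃ p, inU p = x) ∨ ∃ p, inV p = x := by
  obtain ⟨p | p, rfl⟩ := Quotient.exists_rep x
  · exact .inl ⟨p, rfl⟩
  · exact .inr ⟨p, rfl⟩

theorem isOpen_iff {s : Set (Glued g)} :
    IsOpen s ↔ IsOpen (inU ⁻¹' s) ∧ IsOpen (inV ⁻¹' s) := by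
  have h : IsOpen s ↔ IsOpen (Quotient.mk (Gluing.setoid g) ⁻¹' s) :=
    (isQuotientMap_quotient_mk' (s := Gluing.setoid g)).isOpen_preimage.symm
  rw [h, isOpen_sum_iff]
  rfl

theorem isOpenEmbedding_inU : IsOpenEmbedding (inU : F → Glued g) := by
  refine .of_continuous_injective_isOpenMap ?_ inU_injective ?_
  · exact ⟨fun s hs => (isOpen_iff.1 hs).1⟩
  · intro s hs
    refine isOpen_iff.2 ⟨by rwa [inU_injective.preimage_image], ?_⟩
    have : (inV : F → Glued g) ⁻¹' (inU '' s) = g '' (g.source ∩ s) := by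
      ext q
      constructor
      · rintro ⟨p, hp, h⟩
        obtain ⟨h₁, h₂⟩ := inU_eq_inV_iff.1 h
        exact ⟨p, ⟨h₁, hp⟩, h₂⟩
      · rintro ⟨p, ⟨h₁, hp⟩, h₂⟩
        exact ⟨p, hp, inU_eq_inV_iff.2 ⟨h₁, h₂⟩⟩
    rw [this]
    exact g.isOpen_image_source_inter hs

theorem isOpenEmbedding_inV : IsOpenEmbedding (inV : F → Glued g) := by
  refine .of_continuous_injective_isOpenMap ?_ inV_injective ?_
  · exact ⟨fun s hs => (isOpen_iff.1 hs).2⟩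
  · intro s hs
    refine isOpen_iff.2 ⟨?_, by rwa [inV_injective.preimage_image]⟩
    have : (inU : F → Glued g) ⁻¹' (inV '' s) = g.source ∩ g ⁻¹' s := by
      ext p
      constructor
      · rintro ⟨q, hq, h⟩
        obtain ⟨h₁, rfl⟩ := inU_eq_inV_iff.1 h.symm
        exact ⟨h₁, hq⟩
      · rintro ⟨h₁, h₂⟩
        exact ⟨g p, h₂, (inU_eq_inV_iff.2 ⟨h₁, rfl⟩).symm⟩
    rw [this]
    exact g.isOpen_inter_preimage hs

variable [Nonempty F]

/-- The coordinate chart on `U`. -/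
def chartU (g : OpenPartialHomeomorph F F) : OpenPartialHomeomorph (Glued g) F :=
  (isOpenEmbedding_inU.toOpenPartialHomeomorph inU).symm

/-- The coordinate chart on `V`. -/
def chartV (g : OpenPartialHomeomorph F F) : OpenPartialHomeomorph (Glued g) F :=
  (isOpenEmbedding_inV.toOpenPartialHomeomorph inV).symm

theorem chartU_source : (chartU g).source = range inU := by
  simp [chartU]

theorem chartV_source : (chartV g).source = range inV := by
  simp [chartV]

theorem chartU_symm_apply (p : F) : (chartU g).symm p = inU p := rfl

theorem chartV_symm_apply (p : F) : (chartV g).symm p = inV p := rfl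

theorem chartU_inU (p : F) : chartU g (inU p) = p :=
  isOpenEmbedding_inU.toOpenPartialHomeomorph_left_inv inU

theorem chartV_inV (p : F) : chartV g (inV p) = p :=
  isOpenEmbedding_inV.toOpenPartialHomeomorph_left_inv inV

/-- The atlas consisting of the two charts `U` and `V`. -/
instance : ChartedSpace F (Glued g) where
  atlas := {chartU g, chartV g}
  chartAt x := by
    classical
    exact if x ∈ range inU then chartU g else chartV g
  mem_chart_source x := by
    split_ifs with h
    · rwa [chartU_source]
    · rw [chartV_source]
      exact (exists_rep x).resolve_left h
  chart_mem_atlas x := by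
    split_ifs <;> simp

end Glued

/-- A space glued along a biholomorphic transition map is a complex manifold. -/
theorem Glued.isManifold {F : Type*} [NormedAddCommGroup F] [NormedSpace ℂ F]
    (g : OpenPartialHomeomorph F F) (hg : ContDiffOn ℂ ω g g.source)
    (hg' : ContDiffOn ℂ ω g.symm g.target) : IsManifold 𝓘(ℂ, F) ω (Glued g) := by
  apply isManifold_of_contDiffOn
  have key : ∀ e e' : OpenPartialHomeomorph (Glued g) F,
      (e = chartU g ∨ e = chartV g) → (e' = chartU g ∨ e' = chartV g) →
      ContDiffOn ℂ ω (e.symm.trans e') (e.symm.trans e').source := by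
    rintro e e' (rfl | rfl) (rfl | rfl)
    · exact contDiffOn_id.congr fun p _ => chartU_inU p
    · have hs : ∀ p ∈ ((chartU g).symm.trans (chartV g)).source, p ∈ g.source ∧
          (chartV g) (inU p) = g p := by
        intro p hp
        have h : (inU p : Glued g) ∈ (chartV g).source := hp.2
        rw [chartV_source] at h
        obtain ⟨q, hq⟩ := h
        obtain ⟨h₁, rfl⟩ := inU_eq_inV_iff.1 hq.symm
        exact ⟨h₁, by rw [← hq, chartV_inV]⟩
      exact (hg.mono fun p hp => (hs p hp).1).congr fun p hp => (hs p hp).2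
    · have hs : ∀ q ∈ ((chartV g).symm.trans (chartU g)).source, q ∈ g.target ∧
          (chartU g) (inV q) = g.symm q := by
        intro q hq
        have h : (inV q : Glued g) ∈ (chartU g).source := hq.2
        rw [chartU_source] at h
        obtain ⟨p, hp⟩ := h
        obtain ⟨h₁, rfl⟩ := inU_eq_inV_iff.1 hp
        exact ⟨g.map_source h₁, by rw [← hp, chartU_inU, g.left_inv h₁]⟩
      exact (hg'.mono fun p hp => (hs p hp).1).congr fun p hp => (hs p hp).2
    · exact contDiffOn_id.congr fun p _ => chartV_inV p
  intro e e' he he'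
  simpa using key e e' he he'

/-! ### The threefolds `W_k` -/

/-- Coordinates `(z, u₁, u₂)`. -/
abbrev C3 : Type := ℂ × ℂ × ℂ

/-- The transition `(z, u₁, u₂) ↦ (z⁻¹, z⁻ᵃ u₁, z⁻ᵇ u₂)` of `Tot(𝒪(a) ⊕ 𝒪(b))` over `ℙ¹`, a
homeomorphism of `{z ≠ 0}` onto `{ξ ≠ 0}`. -/
def totTransition (a b : ℤ) : OpenPartialHomeomorph C3 C3 where
  toFun p := (p.1⁻¹, p.1 ^ (-a) * p.2.1, p.1 ^ (-b) * p.2.2)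
  invFun q := (q.1⁻¹, q.1 ^ (-a) * q.2.1, q.1 ^ (-b) * q.2.2)
  source := {p | p.1 ≠ 0}
  target := {q | q.1 ≠ 0}
  map_source' p hp := inv_ne_zero hp
  map_target' p hp := inv_ne_zero hp
  left_inv' := by
    rintro ⟨z, u, w⟩ (hz : z ≠ 0)
    have h : ∀ (n : ℤ) (y : ℂ), z⁻¹ ^ n * (z ^ n * y) = y := fun n y => by
      rw [← mul_assoc, ← mul_zpow, inv_mul_cancel₀ hz, one_zpow, one_mul]
    simp only [inv_inv, h]
  right_inv' := by
    rintro ⟨z, u, w⟩ (hz : z ≠ 0)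
    have h : ∀ (n : ℤ) (y : ℂ), z⁻¹ ^ n * (z ^ n * y) = y := fun n y => by
      rw [← mul_assoc, ← mul_zpow, inv_mul_cancel₀ hz, one_zpow, one_mul]
    simp only [inv_inv, h]
  open_source := isOpen_ne_fun continuous_fst continuous_const
  open_target := isOpen_ne_fun continuous_fst continuous_const
  continuousOn_toFun := by
    have h : ∀ n : ℤ, ContinuousOn (fun p : C3 => p.1 ^ n) {p | p.1 ≠ 0} := fun n =>
      continuousOn_fst.zpow₀ n fun p hp => .inl hp
    exact (continuousOn_fst.inv₀ fun p hp => hp).prodMk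
      (((h _).mul (by fun_prop)).prodMk ((h _).mul (by fun_prop)))
  continuousOn_invFun := by
    have h : ∀ n : ℤ, ContinuousOn (fun p : C3 => p.1 ^ n) {p | p.1 ≠ 0} := fun n =>
      continuousOn_fst.zpow₀ n fun p hp => .inl hp
    exact (continuousOn_fst.inv₀ fun p hp => hp).prodMk
      (((h _).mul (by fun_prop)).prodMk ((h _).mul (by fun_prop)))

/-- The total space of `𝒪(a) ⊕ 𝒪(b)` over `ℙ¹`, in its two canonical charts. -/
abbrev Tot (a b : ℤ) : Type := Glued (totTransition a b)

theorem totTransition_contDiffOn (a b : ℤ) :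
    ContDiffOn ℂ ω (fun p : C3 => (p.1⁻¹, p.1 ^ (-a) * p.2.1, p.1 ^ (-b) * p.2.2))
      {p : C3 | p.1 ≠ 0} := by
  have h0 : ContDiffOn ℂ ω (fun p : C3 => p.1⁻¹) {p : C3 | p.1 ≠ 0} :=
    contDiffOn_fst.inv fun p hp => hp
  have h : ∀ n : ℤ, ContDiffOn ℂ ω (fun p : C3 => p.1 ^ n) {p : C3 | p.1 ≠ 0} := by
    intro n
    cases n with
    | ofNat n => simpa using contDiffOn_fst.pow n
    | negSucc n => simpa [zpow_negSucc] using h0.pow (n + 1)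
  exact h0.prodMk (((h _).mul (by fun_prop)).prodMk ((h _).mul (by fun_prop)))

instance (a b : ℤ) : IsManifold 𝓘(ℂ, C3) ω (Tot a b) :=
  Glued.isManifold _ (totTransition_contDiffOn a b) (totTransition_contDiffOn a b)

/-- `W_k = Tot(𝒪(-k) ⊕ 𝒪(k-2))`, so that `(ξ, v₁, v₂) = (z⁻¹, zᵏ u₁, z²⁻ᵏ u₂)`. -/
abbrev W (k : ℤ) : Type := Tot (-k) (k - 2)

/-! ### First Čech cohomology of the tangent sheaf for a cover by two open sets -/

section Cech

variable {F : Type*} [NormedAddCommGroup F] [NormedSpace ℂ F]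
  (X : Type*) [TopologicalSpace X] [ChartedSpace F X]

/-- All (not necessarily continuous) vector fields on `X`. -/
abbrev VField : Type _ := (x : X) → TangentSpace 𝓘(ℂ, F) x

variable {X}

/-- `Γ(O, TX)`: vector fields holomorphic on `O`. Values outside `O` are not constrained; they are
divided out in `CechH1`. -/
def holVField [IsManifold 𝓘(ℂ, F) ω X] (O : Set X) : Submodule ℂ (VField (F := F) X) where
  carrier := {s | ContMDiffOn 𝓘(ℂ, F) 𝓘(ℂ, F).tangent ω
    (fun x => (⟨x, s x⟩ : TangentBundle 𝓘(ℂ, F) X)) O}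
  add_mem' hs ht := ContMDiffOn.add_section hs ht
  zero_mem' := (Bundle.contMDiff_zeroSection ℂ (TangentSpace 𝓘(ℂ, F) : X → Type _)).contMDiffOn
  smul_mem' _ _ hs := ContMDiffOn.const_smul_section hs

/-- Vector fields that agree on `O` with a difference of an element of `SU` and one of `SV`. -/
def coboundaries (SU SV : Submodule ℂ (VField (F := F) X)) (O : Set X) :
    Submodule ℂ (VField (F := F) X) where
  carrier := {s | ∃ a ∈ SU, ∃ b ∈ SV, ∀ x ∈ O, s x = a x - b x}
  add_mem' := by
    rintro s t ⟨a, ha, b, hb, h⟩ ⟨a', ha', b', hb', h'⟩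
    refine ⟨a + a', SU.add_mem ha ha', b + b', SV.add_mem hb hb', fun x hx => ?_⟩
    rw [Pi.add_apply, Pi.add_apply, Pi.add_apply, h x hx, h' x hx]
    abel
  zero_mem' := ⟨0, SU.zero_mem, 0, SV.zero_mem, fun x _ => (sub_zero _).symm⟩
  smul_mem' := by
    rintro c s ⟨a, ha, b, hb, h⟩
    refine ⟨c • a, SU.smul_mem c ha, c • b, SV.smul_mem c hb, fun x hx => ?_⟩
    rw [Pi.smul_apply, Pi.smul_apply, Pi.smul_apply, h x hx, smul_sub]

/-- `Γ(U ∩ V) / (Γ(U) + Γ(V))`, where `SU`, `SV`, `S` are the sections over `U`, `V`, `O = U ∩ V`. -/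
abbrev CechH1 (SU SV S : Submodule ℂ (VField (F := F) X)) (O : Set X) : Type _ :=
  S ⧸ (coboundaries SU SV O).submoduleOf S

/-- `H¹({U, V}, TX)` for the holomorphic tangent sheaf of `X`. -/
abbrev TangentH1 [IsManifold 𝓘(ℂ, F) ω X] (U V : Set X) : Type _ :=
  CechH1 (holVField (F := F) U) (holVField V) (holVField (U ∩ V)) (U ∩ V)

end Cech

/-! ### Deformations and their Kodaira–Spencer classes -/

section Deformation

variable {F : Type*} [NormedAddCommGroup F] [NormedSpace ℂ F]
  {X : Type*} [TopologicalSpace X] [ChartedSpace F X]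
  {G : Type*} [NormedAddCommGroup G] [NormedSpace ℂ G]
  {M : Type*} [TopologicalSpace M] [ChartedSpace G M]
  {E : Type*} [NormedAddCommGroup E] [NormedSpace ℂ E]

/-- `π : M → E`, together with `ι : X → M`, is a deformation of the complex manifold `X` with base
the complex vector space `E` and central fibre over `b`: `π` is a surjective holomorphic submersion
of complex manifolds, `ι` is a biholomorphism of `X` onto the fibre `π⁻¹(b)`, and the family is
trivial as a family of `C^∞` manifolds, compatibly with `ι` (only the complex structure varies). -/
structure IsDeformation [NormedSpace ℝ F] [IsScalarTower ℝ ℂ F]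
    [NormedSpace ℝ G] [IsScalarTower ℝ ℂ G] [NormedSpace ℝ E] [IsScalarTower ℝ ℂ E]
    [IsManifold 𝓘(ℂ, F) ω X] [IsManifold 𝓘(ℂ, G) ω M]
    (ι : X → M) (π : M → E) (b : E) : Prop where
  hausdorff : T2Space M
  submersion : Manifold.IsSubmersion 𝓘(ℂ, G) 𝓘(ℂ, E) ω π
  surjective : Function.Surjective π
  embedding : Manifold.IsSmoothEmbedding 𝓘(ℂ, F) 𝓘(ℂ, G) ω ι
  range_eq : range ι = π ⁻¹' {b}
  smoothly_trivial : ∃ Ψ : Diffeomorph 𝓘(ℝ, G) (𝓘(ℝ, F).prod 𝓘(ℝ, E)) M (X × E) ∞,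
    (∀ m, (Ψ m).2 = π m) ∧ ∀ x, Ψ (ι x) = (x, b)

/-- A holomorphic lift over `O ⊆ X` of the tangent vector `e` of the base: a holomorphic section
of `ι^* TM` over `O` which is mapped to `e` by `dπ`. -/
structure IsLift [IsManifold 𝓘(ℂ, G) ω M] (ι : X → M) (π : M → E) (O : Set X) (e : E)
    (a : (x : X) → TangentSpace 𝓘(ℂ, G) (ι x)) : Prop where
  holomorphic : ContMDiffOn 𝓘(ℂ, F) 𝓘(ℂ, G).tangent ω
    (fun x => (⟨ι x, a x⟩ : TangentBundle 𝓘(ℂ, G) M)) O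
  lift : ∀ x ∈ O, mfderiv 𝓘(ℂ, G) 𝓘(ℂ, E) π (ι x) (a x) = e

/-- `c` is the Kodaira–Spencer class of the tangent vector `e` of the base: the image of `e` under
the connecting map of `0 → TX → ι^* TM → E → 0`, that is, `c` is represented by the difference
`a_U - a_V` of holomorphic lifts of `e` over `U` and over `V`. -/
def IsKodairaSpencerClass [IsManifold 𝓘(ℂ, F) ω X] [IsManifold 𝓘(ℂ, G) ω M]
    (ι : X → M) (π : M → E) (U V : Set X) (e : E) (c : TangentH1 (F := F) U V) : Prop :=
  ∃ θ : holVField (F := F) (U ∩ V), Submodule.Quotient.mk θ = c ∧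
    ∃ a b : (x : X) → TangentSpace 𝓘(ℂ, G) (ι x),
      IsLift (F := F) ι π U e a ∧ IsLift (F := F) ι π V e b ∧
      ∀ x ∈ U ∩ V, mfderiv 𝓘(ℂ, F) 𝓘(ℂ, G) ι x (θ.1 x) = a x - b x

end Deformation

/-! ### Vector fields on `W₂` in canonical coordinates -/

/-- The chart domain `U = {(z, u₁, u₂)}` of `W₂`. -/
def W2U : Set (W 2) := range Glued.inU

/-- The chart domain `V = {(ξ, v₁, v₂)}` of `W₂`. -/
def W2V : Set (W 2) := range Glued.inV

/-- On `U ∩ V = {z ≠ 0}`, the vector field `s` has components `σ` in the coordinates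
`(z, u₁, u₂)`. -/
def HasCoords (s : VField (F := C3) (W 2)) (σ : C3 → C3) : Prop :=
  ∀ p : C3, p.1 ≠ 0 → s (Glued.inU p) = mfderiv 𝓘(ℂ, C3) 𝓘(ℂ, C3) Glued.inU p (σ p)

/-- `H¹(W₂, TW₂)`: holomorphic tangent fields, with respect to the canonical cover `{U, V}`. -/
abbrev H1TW2 : Type := TangentH1 (F := C3) W2U W2V

/-- Polynomial functions of three variables. -/
def polyFun : Subalgebra ℂ (C3 → ℂ) :=
  Algebra.adjoin ℂ {fun p => p.1, fun p => p.2.1, fun p => p.2.2}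

/-- Polynomial maps `ℂ³ → ℂ³`. -/
def polyMap : Submodule ℂ (C3 → C3) where
  carrier := {P | (fun p => (P p).1) ∈ polyFun ∧ (fun p => (P p).2.1) ∈ polyFun ∧
    (fun p => (P p).2.2) ∈ polyFun}
  add_mem' ha hb := ⟨add_mem ha.1 hb.1, add_mem ha.2.1 hb.2.1, add_mem ha.2.2 hb.2.2⟩
  zero_mem' := ⟨zero_mem _, zero_mem _, zero_mem _⟩
  smul_mem' c _ ha :=
    ⟨polyFun.smul_mem ha.1 c, polyFun.smul_mem ha.2.1 c, polyFun.smul_mem ha.2.2 c⟩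

/-- Vector fields that are algebraic (polynomial) on `U`. -/
def algU : Submodule ℂ (VField (F := C3) (W 2)) where
  carrier := {s | ∃ P ∈ polyMap, ∀ p,
    s (Glued.inU p) = mfderiv 𝓘(ℂ, C3) 𝓘(ℂ, C3) Glued.inU p (P p)}
  add_mem' := by
    rintro s t ⟨P, hP, h⟩ ⟨Q, hQ, h'⟩
    refine ⟨P + Q, add_mem hP hQ, fun p => ?_⟩
    rw [Pi.add_apply, h, h']
    exact (map_add (mfderiv 𝓘(ℂ, C3) 𝓘(ℂ, C3) Glued.inU p) (P p) (Q p)).symm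
  zero_mem' := ⟨0, zero_mem _, fun p =>
    (map_zero (mfderiv 𝓘(ℂ, C3) 𝓘(ℂ, C3) Glued.inU p)).symm⟩
  smul_mem' := by
    rintro c s ⟨P, hP, h⟩
    refine ⟨c • P, polyMap.smul_mem c hP, fun p => ?_⟩
    rw [Pi.smul_apply, h]
    exact (map_smul (mfderiv 𝓘(ℂ, C3) 𝓘(ℂ, C3) Glued.inU p) c (P p)).symm

/-- Vector fields that are algebraic (polynomial) on `V`. -/
def algV : Submodule ℂ (VField (F := C3) (W 2)) where
  carrier := {s | ∃ P ∈ polyMap, ∀ p,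
    s (Glued.inV p) = mfderiv 𝓘(ℂ, C3) 𝓘(ℂ, C3) Glued.inV p (P p)}
  add_mem' := by
    rintro s t ⟨P, hP, h⟩ ⟨Q, hQ, h'⟩
    refine ⟨P + Q, add_mem hP hQ, fun p => ?_⟩
    rw [Pi.add_apply, h, h']
    exact (map_add (mfderiv 𝓘(ℂ, C3) 𝓘(ℂ, C3) Glued.inV p) (P p) (Q p)).symm
  zero_mem' := ⟨0, zero_mem _, fun p =>
    (map_zero (mfderiv 𝓘(ℂ, C3) 𝓘(ℂ, C3) Glued.inV p)).symm⟩
  smul_mem' := by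
    rintro c s ⟨P, hP, h⟩
    refine ⟨c • P, polyMap.smul_mem c hP, fun p => ?_⟩
    rw [Pi.smul_apply, h]
    exact (map_smul (mfderiv 𝓘(ℂ, C3) 𝓘(ℂ, C3) Glued.inV p) c (P p)).symm

/-- Vector fields that are algebraic on `U ∩ V`: components in `ℂ[z, z⁻¹, u₁, u₂]`. -/
def algUV : Submodule ℂ (VField (F := C3) (W 2)) where
  carrier := {s | ∃ n : ℕ, ∃ P ∈ polyMap, HasCoords s fun p => (p.1 ^ n)⁻¹ • P p}
  add_mem' := by
    rintro s t ⟨n, P, hP, h⟩ ⟨m, Q, hQ, h'⟩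
    have hz : ∀ k : ℕ, (fun p : C3 => p.1 ^ k) ∈ polyFun := fun k =>
      pow_mem (Algebra.subset_adjoin (by simp)) k
    refine ⟨n + m, fun p => p.1 ^ m • P p + p.1 ^ n • Q p,
      add_mem ⟨mul_mem (hz m) hP.1, mul_mem (hz m) hP.2.1, mul_mem (hz m) hP.2.2⟩
        ⟨mul_mem (hz n) hQ.1, mul_mem (hz n) hQ.2.1, mul_mem (hz n) hQ.2.2⟩, fun p hp => ?_⟩
    have e : (p.1 ^ (n + m))⁻¹ • (p.1 ^ m • P p + p.1 ^ n • Q p)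
        = (p.1 ^ n)⁻¹ • P p + (p.1 ^ m)⁻¹ • Q p := by
      rw [smul_add, smul_smul, smul_smul]
      congr 2 <;> field_simp <;> ring
    rw [Pi.add_apply, h p hp, h' p hp]
    simp only [e]
    exact (map_add (mfderiv 𝓘(ℂ, C3) 𝓘(ℂ, C3) Glued.inU p) _ _).symm
  zero_mem' := ⟨0, 0, zero_mem _, fun p _ => by
    simp only [Pi.zero_apply, smul_zero]
    exact (map_zero (mfderiv 𝓘(ℂ, C3) 𝓘(ℂ, C3) Glued.inU p)).symm⟩
  smul_mem' := by
    rintro c s ⟨n, P, hP, h⟩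
    refine ⟨n, c • P, polyMap.smul_mem c hP, fun p hp => ?_⟩
    rw [Pi.smul_apply, h p hp]
    simp only [Pi.smul_apply]
    rw [smul_comm]
    exact (map_smul (mfderiv 𝓘(ℂ, C3) 𝓘(ℂ, C3) Glued.inU p) c _).symm

/-- `H¹(W₂, TW₂)` of the algebraic tangent sheaf, with respect to the canonical cover `{U, V}`. -/
abbrev H1TW2alg : Type := CechH1 algU algV algUV (W2U ∩ W2V)

/-! ### The explicit family -/

/-- The parameters `t = (t₀, t₁, …)` for which `∑ tⱼ wʲ` converges for every `w ∈ ℂ`. -/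
def Param : Submodule ℂ (ℕ → ℂ) where
  carrier := {t | ∀ w : ℂ, Summable fun j => t j * w ^ j}
  add_mem' hs ht w := by
    simpa [add_mul] using (hs w).add (ht w)
  zero_mem' w := by simp
  smul_mem' c t ht w := by
    simpa [mul_assoc] using (ht w).mul_left c

/-- The entire function `∑ⱼ tⱼ wʲ`. -/
def entireSum (t : Param) (w : ℂ) : ℂ := ∑' j, t.1 j * w ^ j

/-- The parameter whose `j`-th entry is `1` and whose other entries are `0`. -/
def Param.single (j : ℕ) : Param :=
  ⟨Pi.single j 1, fun w => summable_of_ne_finset_zero (s := {j}) fun i hi => by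
    rw [Pi.single_eq_of_ne (by simpa using hi), zero_mul]⟩

section Family

variable {E : Type} [NormedAddCommGroup E] [NormedSpace ℂ E]

/-- The coordinates `t₀, t₁, …`, as linear functions on `E`, make `∑ⱼ tⱼ(e) wʲ` a holomorphic
function of `(e, w) ∈ E × ℂ`. -/
def IsHolParam (L : E →ₗ[ℂ] Param) : Prop :=
  ContDiff ℂ ω fun q : E × ℂ => entireSum (L q.1) q.2

/-- The transition `(ξ, v₁, v₂, e) = (z⁻¹, z² u₁ + ∑ⱼ tⱼ(e) z u₂ʲ, u₂, e)`. -/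
def famTransition (L : E →ₗ[ℂ] Param) (hL : IsHolParam L) :
    OpenPartialHomeomorph (C3 × E) (C3 × E) where
  toFun p := ((p.1.1⁻¹, p.1.1 ^ 2 * p.1.2.1 + p.1.1 * entireSum (L p.2) p.1.2.2, p.1.2.2), p.2)
  invFun q := ((q.1.1⁻¹, q.1.1 ^ 2 * q.1.2.1 - q.1.1 * entireSum (L q.2) q.1.2.2, q.1.2.2), q.2)
  source := {p | p.1.1 ≠ 0}
  target := {q | q.1.1 ≠ 0}
  map_source' p hp := inv_ne_zero hp
  map_target' p hp := inv_ne_zero hp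
  left_inv' := by
    rintro ⟨⟨z, u, w⟩, e⟩ (hz : z ≠ 0)
    simp only [Prod.mk.injEq, and_true, inv_inv, true_and]
    field_simp
    ring
  right_inv' := by
    rintro ⟨⟨z, u, w⟩, e⟩ (hz : z ≠ 0)
    simp only [Prod.mk.injEq, and_true, inv_inv, true_and]
    field_simp
    ring
  open_source := isOpen_ne_fun (by fun_prop) continuous_const
  open_target := isOpen_ne_fun (by fun_prop) continuous_const
  continuousOn_toFun := by
    have h : Continuous fun p : C3 × E => entireSum (L p.2) p.1.2.2 :=
      hL.continuous.comp (g := fun q : E × ℂ => entireSum (L q.1) q.2)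
        (f := fun p : C3 × E => (p.2, p.1.2.2)) (by fun_prop)
    have h0 : ContinuousOn (fun p : C3 × E => p.1.1⁻¹) {p | p.1.1 ≠ 0} :=
      ContinuousOn.inv₀ (by fun_prop) fun p hp => hp
    exact (h0.prodMk (Continuous.continuousOn (by fun_prop))).prodMk (by fun_prop)
  continuousOn_invFun := by
    have h : Continuous fun p : C3 × E => entireSum (L p.2) p.1.2.2 :=
      hL.continuous.comp (g := fun q : E × ℂ => entireSum (L q.1) q.2)
        (f := fun p : C3 × E => (p.2, p.1.2.2)) (by fun_prop)
    have h0 : ContinuousOn (fun p : C3 × E => p.1.1⁻¹) {p | p.1.1 ≠ 0} :=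
      ContinuousOn.inv₀ (by fun_prop) fun p hp => hp
    exact (h0.prodMk (Continuous.continuousOn (by fun_prop))).prodMk (by fun_prop)

/-- The total space `(U × E) ∪ (V × E)` of the explicit family. -/
abbrev Fam (L : E →ₗ[ℂ] Param) (hL : IsHolParam L) : Type := Glued (famTransition L hL)

instance (L : E →ₗ[ℂ] Param) (hL : IsHolParam L) : IsManifold 𝓘(ℂ, C3 × E) ω (Fam L hL) := by
  have h : ContDiff ℂ ω fun p : C3 × E => entireSum (L p.2) p.1.2.2 :=
    ContDiff.comp (g := fun q : E × ℂ => entireSum (L q.1) q.2)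
      (f := fun p : C3 × E => (p.2, p.1.2.2)) hL (by fun_prop)
  have h0 : ContDiffOn ℂ ω (fun p : C3 × E => p.1.1⁻¹) {p | p.1.1 ≠ 0} :=
    ContDiffOn.inv (by fun_prop) fun p hp => hp
  refine Glued.isManifold _ ?_ ?_
  · exact (h0.prodMk (ContDiff.contDiffOn (by fun_prop))).prodMk (by fun_prop)
  · exact (h0.prodMk (ContDiff.contDiffOn (by fun_prop))).prodMk (by fun_prop)

/-- The projection of the family to its base. -/
def Fam.proj (L : E →ₗ[ℂ] Param) (hL : IsHolParam L) : Fam L hL → E :=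
  Glued.lift Prod.snd Prod.snd fun _ _ => rfl

/-- The identification of `W₂` with the fibre over `0`. -/
def Fam.incl (L : E →ₗ[ℂ] Param) (hL : IsHolParam L) : W 2 → Fam L hL :=
  Glued.lift (fun p => Glued.inU (p, 0)) (fun q => Glued.inV (q, 0)) (by
    intro p hp
    refine Glued.inU_eq_inV_iff.2 ⟨hp, ?_⟩
    simp [famTransition, totTransition, entireSum])

end Family

end

/-!
A function on `U ∩ V` is the sum of a function on `U` and of a function of `(ξ, u₁, u₂)` vanishing
at `ξ = 0`, by Cauchy's integral formula on circles around `z = 0` and around `z = ∞`. Splitting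
the components of a vector field on `U ∩ V` in this way, and absorbing into `V` whatever extends
there, leaves the fields `(0, z⁻¹ T(u₂), 0)`. None of these is a coboundary unless `T = 0`, by
Liouville's theorem in `z`.

The family is trivialized smoothly by a shift of the coordinate `u₁` alone: with
`φ(z) = z̄ / (1 + |z|²)` one has `z = z² φ(z) + φ(z⁻¹)` for `z ≠ 0`, so that the cocycle
`z ∑ⱼ tⱼ(e) u₂ʲ` is a difference of smooth functions on `U` and `V`. Lifting `e` to both charts by
the constant field in their coordinates, the two lifts differ by `(0, z⁻¹ ∑ⱼ tⱼ(e) u₂ʲ, 0)`, which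
gives the Kodaira–Spencer class.

For an infinite-dimensional base take the bounded sequences `x` with `tⱼ(x) = xⱼ / j!`: if `S`
denotes the left shift, then `∑ⱼ tⱼ(x) wʲ` is the value at `0` of `exp(w S) x`, which is jointly
holomorphic because the exponential of a Banach algebra is.
-/

noncomputable section

/-! ### Analytic dependence of integrals on parameters -/

section AnalyticIntegral

open MeasureTheory
open scoped NNReal ENNReal

variable {Z Q G : Type*} [NormedAddCommGroup Z] [NormedSpace ℂ Z] [NormedAddCommGroup Q]
  [NormedSpace ℂ Q] [NormedAddCommGroup G] [NormedSpace ℂ G]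

theorem exists_summable_bound_changeOrigin {P : FormalMultilinearSeries ℂ Z G} {r s : ℝ≥0}
    (h : (r + s : ℝ≥0∞) < P.radius) :
    ∃ b : ℕ → ℝ≥0, (Summable fun n => b n * s ^ n) ∧
      ∀ y, ‖y‖₊ ≤ r → ∀ n, ‖P.changeOrigin y n‖₊ ≤ b n := by
  have hr : (r : ℝ≥0∞) < P.radius := le_self_add.trans_lt h
  refine ⟨fun n => ∑' s : Σ l : ℕ, { s : Finset (Fin (n + l)) // s.card = l },
    ‖P (n + s.1)‖₊ * r ^ s.1, ?_, fun y hy n => ?_⟩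
  · simp only [← NNReal.tsum_mul_right]
    exact (NNReal.summable_sigma.1 (P.changeOriginSeries_summable_aux₁ h)).2
  · have hyP : (‖y‖₊ : ℝ≥0∞) < P.radius := (ENNReal.coe_le_coe.2 hy).trans_lt hr
    refine (P.nnnorm_changeOrigin_le n hyP).trans <| Summable.tsum_le_tsum (fun s => ?_)
      (P.changeOriginSeries_summable_aux₂ hyP n) (P.changeOriginSeries_summable_aux₂ hr n)
    gcongr

theorem exists_hasFPowerSeriesOnBall_slice [CompleteSpace G] {F : Z × Q → G} {z₀ : Z} {p : Q}
    (hF : AnalyticAt ℂ F (z₀, p)) :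
    ∃ (r : ℝ≥0) (c : Z → FormalMultilinearSeries ℂ Q G) (b : ℕ → ℝ≥0), 0 < r ∧
      (Summable fun n => b n * r ^ n) ∧ ∀ᶠ z in 𝓝 z₀,
        HasFPowerSeriesOnBall (fun q => F (z, q)) (c z) p r ∧
        ∀ n, ‖c z n‖₊ ≤ b n ∧ ContinuousAt (fun z => c z n) z := by
  obtain ⟨P, R, hP⟩ := hF
  obtain ⟨r, hr, hrR⟩ : ∃ r : ℝ≥0, 0 < r ∧ (r + r : ℝ≥0∞) < R := by
    obtain ⟨s, hs, hsR⟩ := ENNReal.lt_iff_exists_nnreal_btwn.1 hP.r_pos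
    refine ⟨s / 2, by simpa using hs, ?_⟩
    rwa [← ENNReal.coe_add, add_halves]
  obtain ⟨b, hb, hPb⟩ := exists_summable_bound_changeOrigin (hrR.trans_le hP.r_le)
  let ι : Q →L[ℂ] Z × Q := ContinuousLinearMap.inr ℂ Z Q
  let τ : Z → Z × Q := fun z => (z - z₀, 0)
  let c : Z → FormalMultilinearSeries ℂ Q G := fun z =>
    (P.changeOrigin (τ z)).compContinuousLinearMap ι
  refine ⟨r, c, b, hr, hb, ?_⟩
  filter_upwards [Metric.ball_mem_nhds z₀ (NNReal.coe_pos.2 hr)] with z hz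
  have hτr : ‖τ z‖₊ < r := by
    simpa [τ, Prod.nnnorm_def, ← NNReal.coe_lt_coe, hr] using mem_ball_iff_norm.1 hz
  have hτR : (‖τ z‖₊ + r : ℝ≥0∞) < R := lt_of_le_of_lt (by gcongr) hrR
  have hτ : (‖τ z‖₊ : ℝ≥0∞) < R := le_self_add.trans_lt hτR
  have hcb : ∀ n, ‖c z n‖₊ ≤ b n := fun n =>
    calc ‖c z n‖₊ ≤ ‖P.changeOrigin (τ z) n‖₊ * ‖ι‖₊ ^ n :=
          (P.changeOrigin (τ z)).nnnorm_compContinuousLinearMap_le ι n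
      _ ≤ ‖P.changeOrigin (τ z) n‖₊ * 1 := by
          gcongr
          exact pow_le_one₀ (by positivity) (ContinuousLinearMap.norm_inr_le_one ℂ Z Q)
      _ ≤ b n := (mul_one _).trans_le (hPb _ hτr.le n)
  refine ⟨⟨?_, ENNReal.coe_pos.2 hr, fun {y} hy => ?_⟩, fun n => ⟨hcb n, ?_⟩⟩
  · exact FormalMultilinearSeries.le_radius_of_summable_nnnorm _
      (NNReal.summable_of_le (fun n => by gcongr; exact hcb n) hb)
  · have hy' : ι y ∈ Metric.eball (0 : Z × Q) (R - ‖τ z‖₊) := by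
      refine Metric.eball_subset_eball (ENNReal.le_sub_of_add_le_left (by simp) hτR.le) ?_
      simpa [ι, Prod.edist_eq] using hy
    have hz : (z₀, p) + τ z + ι y = (z, p + y) := by simp [ι, τ]
    exact hz ▸ (hP.changeOrigin hτ).hasSum hy'
  · have hcont : ContinuousAt (fun y => P.changeOrigin y n) (τ z) :=
      (P.hasFPowerSeriesOnBall_changeOrigin n (hP.r_pos.trans_le hP.r_le)).continuousOn.continuousAt
        (Metric.isOpen_eball.mem_nhds (by simpa [enorm] using hτ.trans_le hP.r_le))
    have hcomp : Continuous fun M : ContinuousMultilinearMap ℂ (fun _ : Fin n => Z × Q) G =>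
        M.compContinuousLinearMap fun _ => ι :=
      (ContinuousMultilinearMap.compContinuousLinearMapL fun _ => ι).continuous
    exact hcomp.continuousAt.comp (hcont.comp (f := τ) (by fun_prop))

theorem hasFPowerSeriesOnBall_integral {X : Type*} [MeasurableSpace X] {μ : Measure X}
    [IsFiniteMeasure μ] {f : X → Q → G} {c : X → FormalMultilinearSeries ℂ Q G} {p : Q}
    {r : ℝ≥0} {b : ℕ → ℝ≥0} (hr : 0 < r) (hb : Summable fun n => b n * r ^ n)
    (hf : ∀ᵐ x ∂μ, HasFPowerSeriesOnBall (f x) (c x) p r)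
    (hcb : ∀ᵐ x ∂μ, ∀ n, ‖c x n‖₊ ≤ b n) (hc : ∀ n, AEStronglyMeasurable (fun x => c x n) μ) :
    HasFPowerSeriesOnBall (fun q => ∫ x, f x q ∂μ) (fun n => ∫ x, c x n ∂μ) p r := by
  have hint : ∀ n, Integrable (fun x => c x n) μ := fun n =>
    .of_bound (hc n) (b n) (hcb.mono fun x hx => hx n)
  refine ⟨?_, ENNReal.coe_pos.2 hr, fun {y} hy => ?_⟩
  · refine FormalMultilinearSeries.le_radius_of_summable _ (.of_nonneg_of_le
      (fun n => by positivity) (fun n => ?_) ((NNReal.summable_coe.2 hb).mul_left (μ.real univ)))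
    calc ‖∫ x, c x n ∂μ‖ * (r : ℝ) ^ n ≤ b n * μ.real univ * (r : ℝ) ^ n := by
          gcongr
          exact norm_integral_le_of_norm_le_const (hcb.mono fun x hx => hx n)
      _ = μ.real univ * ↑(b n * r ^ n) := by push_cast; ring
  · simp only [ContinuousMultilinearMap.integral_apply (hint _)]
    have hy' : ‖y‖ ≤ r := (mem_eball_zero_iff.1 hy |> ENNReal.coe_lt_coe.1).le
    refine hasSum_integral_of_dominated_convergence (fun n _ => (b n * r ^ n : ℝ≥0)) (fun n => ?_)
      (fun n => hcb.mono fun x hx => ?_) (.of_forall fun _ => NNReal.summable_coe.2 hb)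
      (integrable_const _) (hf.mono fun x hx => hx.hasSum hy)
    · exact (ContinuousMultilinearMap.apply ℂ (fun _ : Fin n => Q) G
        fun _ => y).continuous.comp_aestronglyMeasurable (hc n)
    · calc ‖c x n fun _ => y‖ ≤ ‖c x n‖ * ‖y‖ ^ n := by
            simpa using (c x n).le_opNorm fun _ => y
        _ ≤ b n * (r : ℝ) ^ n := by gcongr; exact hx n
        _ = ↑(b n * r ^ n) := by push_cast; rfl

variable {X : Type*} [TopologicalSpace X] [MeasurableSpace X] [OpensMeasurableSpace X]
  {μ : Measure X} [CompleteSpace G]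

theorem eventually_analyticAt_setIntegral [SecondCountableTopology X] {F : Z × Q → G}
    {γ : X → Z} {p : Q} {K : Set X} {x₀ : X}
    (hK : μ K ≠ ⊤) (hγ : ContinuousOn γ K) (hx₀ : x₀ ∈ K) (hF : AnalyticAt ℂ F (γ x₀, p)) :
    ∀ᶠ s in (𝓝[K] x₀).smallSets, MeasurableSet s →
      AnalyticAt ℂ (fun q => ∫ x in s, F (γ x, q) ∂μ) p := by
  obtain ⟨r, c, b, hr, hb, h⟩ := exists_hasFPowerSeriesOnBall_slice hF
  filter_upwards [((hγ x₀ hx₀).eventually h).smallSets,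
    (eventually_mem_nhdsWithin (a := x₀) (s := K)).smallSets] with s hs hsK hsm
  have : IsFiniteMeasure (μ.restrict s) :=
    isFiniteMeasure_restrict.2 (measure_ne_top_of_subset hsK hK)
  refine (hasFPowerSeriesOnBall_integral (c := fun x => c (γ x)) hr hb ?_ ?_ fun n => ?_).analyticAt
  · exact ae_restrict_of_forall_mem hsm fun x hx => (hs x hx).1
  · exact ae_restrict_of_forall_mem hsm fun x hx n => ((hs x hx).2 n).1
  · exact ContinuousOn.aestronglyMeasurable (fun x hx => ((hs x hx).2 n).2.comp_continuousWithinAt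
      ((hγ.mono hsK) x hx)) hsm

theorem eventually_integrableOn_slice [IsFiniteMeasureOnCompacts μ] {F : Z × Q → G} {γ : X → Z}
    {p : Q} {K : Set X} (hK : IsCompact K) (hKm : MeasurableSet K) (hγ : ContinuousOn γ K)
    (hF : ∀ x ∈ K, AnalyticAt ℂ F (γ x, p)) :
    ∀ᶠ q in 𝓝 p, IntegrableOn (fun x => F (γ x, q)) K μ := by
  have hev : ∀ᶠ q in 𝓝 p, ∀ z ∈ γ '' K, AnalyticAt ℂ F (z, q) :=
    (hK.image_of_continuousOn hγ).eventually_forall_of_forall_eventually <| by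
      rintro _ ⟨x, hx, rfl⟩
      exact (continuous_swap.tendsto (p, γ x)).eventually (hF x hx).eventually_analyticAt
  filter_upwards [hev] with q hq
  refine ContinuousOn.integrableOn_compact' hK hKm fun x hx => ?_
  exact (hq (γ x) (mem_image_of_mem γ hx)).continuousAt.comp_continuousWithinAt
    (f := fun x => (γ x, q)) ((hγ x hx).prodMk continuousWithinAt_const)

theorem analyticAt_setIntegral [SecondCountableTopology X] [IsFiniteMeasureOnCompacts μ]
    {F : Z × Q → G} {γ : X → Z} {p : Q} {K : Set X} (hK : IsCompact K) (hKm : MeasurableSet K)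
    (hγ : ContinuousOn γ K)
    (hF : ∀ x ∈ K, AnalyticAt ℂ F (γ x, p)) :
    AnalyticAt ℂ (fun q => ∫ x in K, F (γ x, q) ∂μ) p := by
  have hint := eventually_integrableOn_slice (μ := μ) hK hKm hγ hF
  suffices ∃ S, MeasurableSet S ∧ K ⊆ S ∧ ∀ s ⊆ S, s ⊆ K → MeasurableSet s →
      AnalyticAt ℂ (fun q => ∫ x in s, F (γ x, q) ∂μ) p by
    obtain ⟨S, -, hKS, hS⟩ := this
    exact hS K hKS subset_rfl hKm
  refine hK.induction_on (p := fun T => ∃ S, MeasurableSet S ∧ T ⊆ S ∧ ∀ s ⊆ S, s ⊆ K →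
    MeasurableSet s → AnalyticAt ℂ (fun q => ∫ x in s, F (γ x, q) ∂μ) p) ?_ ?_ ?_ ?_
  · refine ⟨∅, .empty, subset_rfl, fun s hs _ _ => ?_⟩
    simpa [subset_empty_iff.1 hs] using analyticAt_const
  · rintro T₁ T₂ h ⟨S, hSm, hTS, hS⟩
    exact ⟨S, hSm, h.trans hTS, hS⟩
  · rintro T₁ T₂ ⟨S₁, hm₁, hT₁, h₁⟩ ⟨S₂, hm₂, hT₂, h₂⟩
    refine ⟨S₁ ∪ S₂, hm₁.union hm₂, union_subset_union hT₁ hT₂, fun s hs hsK hsm => ?_⟩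
    refine ((h₁ (s ∩ S₁) inter_subset_right (inter_subset_left.trans hsK) (hsm.inter hm₁)).add
      (h₂ (s \ S₁) (sdiff_subset_iff.2 hs) (sdiff_subset.trans hsK) (hsm.diff hm₁))).congr ?_
    filter_upwards [hint] with q hq
    exact integral_inter_add_sdiff hm₁ (hq.mono_set hsK)
  · intro x hx
    obtain ⟨t, ht, h⟩ := eventually_smallSets.1
      (eventually_analyticAt_setIntegral (μ := μ) hK.measure_ne_top hγ hx (hF x hx))
    obtain ⟨U, hU, hxU, hUt⟩ := mem_nhdsWithin.1 ht
    exact ⟨U, mem_nhdsWithin_of_mem_nhds (hU.mem_nhds hxU), U, hU.measurableSet, subset_rfl,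
      fun s hsU hsK => h s fun y hy => hUt ⟨hsU hy, hsK hy⟩⟩

theorem analyticAt_intervalIntegral {F : Z × Q → G} {γ : ℝ → Z} {p : Q} {a b : ℝ} (hab : a ≤ b)
    (hγ : ContinuousOn γ (Icc a b)) (hF : ∀ t ∈ Icc a b, AnalyticAt ℂ F (γ t, p)) :
    AnalyticAt ℂ (fun q => ∫ t in a..b, F (γ t, q)) p := by
  simp only [intervalIntegral.integral_of_le hab, ← integral_Icc_eq_integral_Ioc]
  exact analyticAt_setIntegral isCompact_Icc measurableSet_Icc hγ hF

theorem analyticAt_circleIntegral {F : ℂ × Q → G} {p : Q} {c : ℂ} {R : ℝ} (hR : 0 ≤ R)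
    (hF : ∀ ζ ∈ Metric.sphere c R, AnalyticAt ℂ F (ζ, p)) :
    AnalyticAt ℂ (fun q => ∮ ζ in C(c, R), F (ζ, q)) p := by
  have hderiv : ∀ θ, deriv (circleMap c R) θ = (circleMap c R θ - c) * Complex.I := by simp
  simp only [circleIntegral, hderiv]
  refine analyticAt_intervalIntegral (F := fun x => ((x.1 - c) * Complex.I) • F x)
    Real.two_pi_pos.le (continuous_circleMap c R).continuousOn fun θ _ => ?_
  exact ((analyticAt_fst.sub analyticAt_const).mul analyticAt_const).smul
    (hF _ (circleMap_mem_sphere c hR θ))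

end AnalyticIntegral

/-! ### Laurent splitting -/

section Laurent

variable {G : Type*} [NormedAddCommGroup G] [NormedSpace ℂ G]

theorem circleIntegral_comp_inv (g : ℂ → G) (R : ℝ) :
    (∮ ζ in C(0, R⁻¹), g ζ) = ∮ ζ in C(0, R), (ζ ^ 2)⁻¹ • g ζ⁻¹ := by
  rcases eq_or_ne R 0 with rfl | hR
  · simp
  have hmap : ∀ θ, circleMap 0 R⁻¹ (2 * Real.pi - θ) = (circleMap 0 R θ)⁻¹ := fun θ => by
    simpa [circleMap, sub_mul, Complex.exp_sub] using mul_comm _ _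
  calc (∮ ζ in C(0, R⁻¹), g ζ)
      = ∫ θ in (0 : ℝ)..2 * Real.pi, deriv (circleMap 0 R⁻¹) (2 * Real.pi - θ) •
          g (circleMap 0 R⁻¹ (2 * Real.pi - θ)) := by
        rw [intervalIntegral.integral_comp_sub_left
          (fun θ => deriv (circleMap 0 R⁻¹) θ • g (circleMap 0 R⁻¹ θ)), sub_self, sub_zero,
          circleIntegral]
    _ = ∮ ζ in C(0, R), (ζ ^ 2)⁻¹ • g ζ⁻¹ := by
        refine intervalIntegral.integral_congr fun θ _ => ?_
        have hθ : circleMap 0 R θ ≠ 0 := circleMap_ne_center hR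
        simp only [deriv_circleMap, hmap, smul_smul]
        congr 1
        field_simp

theorem circleIntegral_eq_of_differentiableOn {g : ℂ → G} {c : ℂ} {r R : ℝ} {U : Set ℂ}
    (hr : 0 < r) (hrR : r ≤ R) (hU : IsOpen U) (hg : DifferentiableOn ℂ g U)
    (hA : Metric.closedBall c R \ Metric.ball c r ⊆ U) :
    (∮ ζ in C(c, R), g ζ) = ∮ ζ in C(c, r), g ζ := by
  refine Complex.circleIntegral_eq_of_differentiable_on_annulus_off_countable hr hrR
    countable_empty (hg.continuousOn.mono hA) fun ζ hζ => hg.differentiableAt (hU.mem_nhds (hA ?_))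
  exact ⟨Metric.ball_subset_closedBall hζ.1.1, fun h => hζ.1.2 (Metric.ball_subset_closedBall h)⟩

theorem circleIntegral_dslope [CompleteSpace G] {g : ℂ → G} {c z : ℂ} {R : ℝ} (hR : 0 ≤ R)
    (hz : z ∉ Metric.sphere c R) (hg : ContinuousOn g (Metric.sphere c R)) :
    (∮ ζ in C(c, R), dslope g z ζ) =
      (∮ ζ in C(c, R), (ζ - z)⁻¹ • g ζ) - (∮ ζ in C(c, R), (ζ - z)⁻¹) • g z := by
  have hne : ∀ ζ ∈ Metric.sphere c R, ζ ≠ z := fun ζ hζ h => hz (h ▸ hζ)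
  have hinv : ContinuousOn (fun ζ => (ζ - z)⁻¹) (Metric.sphere c R) :=
    (continuousOn_id.sub continuousOn_const).inv₀ fun ζ hζ => sub_ne_zero.2 (hne ζ hζ)
  have hint : CircleIntegrable (fun ζ => (ζ - z)⁻¹ • g ζ) c R :=
    (hinv.smul hg).circleIntegrable hR
  have hint' : CircleIntegrable (fun ζ => (ζ - z)⁻¹ • g z) c R :=
    (hinv.smul continuousOn_const).circleIntegrable hR
  rw [← circleIntegral.integral_smul_const, ← circleIntegral.integral_sub hint hint']
  refine circleIntegral.integral_congr hR fun ζ hζ => ?_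
  simp only [dslope_of_ne _ (hne ζ hζ), slope, vsub_eq_sub, smul_sub]

theorem two_pi_I_smul_eq_circleIntegral_sub_circleIntegral [CompleteSpace G] {g : ℂ → G}
    {c z : ℂ} {r R : ℝ} {U : Set ℂ} (hr : 0 < r) (hrz : r < ‖z - c‖) (hzR : ‖z - c‖ < R)
    (hU : IsOpen U) (hg : DifferentiableOn ℂ g U)
    (hA : Metric.closedBall c R \ Metric.ball c r ⊆ U) :
    (2 * Real.pi * Complex.I : ℂ) • g z =
      (∮ ζ in C(c, R), (ζ - z)⁻¹ • g ζ) - ∮ ζ in C(c, r), (ζ - z)⁻¹ • g ζ := by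
  have hrR : r < R := hrz.trans hzR
  have hzU : U ∈ 𝓝 z := hU.mem_nhds (hA ⟨by simpa [dist_eq_norm] using hzR.le,
    by simpa [dist_eq_norm] using hrz.le⟩)
  have hsplit : ∀ ρ, r ≤ ρ → ρ ≤ R → ρ ≠ ‖z - c‖ → (∮ ζ in C(c, ρ), dslope g z ζ) =
      (∮ ζ in C(c, ρ), (ζ - z)⁻¹ • g ζ) - (∮ ζ in C(c, ρ), (ζ - z)⁻¹) • g z := by
    intro ρ hrρ hρR hρ
    refine circleIntegral_dslope (hr.le.trans hrρ)
      (fun h => hρ (mem_sphere_iff_norm.1 h).symm) (hg.continuousOn.mono fun ζ hζ => hA ⟨?_, ?_⟩)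
    · exact Metric.sphere_subset_closedBall.trans (Metric.closedBall_subset_closedBall hρR) hζ
    · simpa [mem_sphere_iff_norm.1 hζ, dist_eq_norm] using hrρ
  have hR : (∮ ζ in C(c, R), (ζ - z)⁻¹) = 2 * Real.pi * Complex.I :=
    circleIntegral.integral_sub_inv_of_mem_ball (by simpa [dist_eq_norm] using hzR)
  have hr' : (∮ ζ in C(c, r), (ζ - z)⁻¹) = 0 := by
    refine DiffContOnCl.circleIntegral_eq_zero hr.le (DifferentiableOn.diffContOnCl ?_)
    refine (differentiableOn_id.sub_const z).inv fun ζ hζ => sub_ne_zero.2 ?_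
    rintro rfl
    exact hrz.not_ge (by simpa [dist_eq_norm] using Metric.closure_ball_subset_closedBall hζ)
  have h := circleIntegral_eq_of_differentiableOn hr hrR.le hU
    ((Complex.differentiableOn_dslope hzU).2 hg) hA
  rw [hsplit R hrR.le le_rfl hzR.ne', hsplit r le_rfl hrR.le hrz.ne, hR, hr', zero_smul,
    sub_zero] at h
  rw [← h, sub_sub_cancel]

/-- The part of the Laurent expansion of `f` in its first variable with exponents `≥ 0`. The
radius is an arbitrary one larger than `‖q.1‖`. -/
def laurentPlus {Q : Type*} (f : ℂ × Q → G) (q : ℂ × Q) : G :=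
  (2 * Real.pi * Complex.I : ℂ)⁻¹ • ∮ ζ in C(0, ‖q.1‖ + 1), (ζ - q.1)⁻¹ • f (ζ, q.2)

theorem laurentPlus_eq {Q : Type*} {f : ℂ × Q → G} {q : ℂ × Q} {R : ℝ}
    (hf : ∀ z, z ≠ 0 → DifferentiableAt ℂ (fun z => f (z, q.2)) z) (hR : ‖q.1‖ + 1 ≤ R) :
    laurentPlus f q =
      (2 * Real.pi * Complex.I : ℂ)⁻¹ • ∮ ζ in C(0, R), (ζ - q.1)⁻¹ • f (ζ, q.2) := by
  rw [laurentPlus, circleIntegral_eq_of_differentiableOn (by positivity) hR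
    (U := (Metric.closedBall 0 ‖q.1‖)ᶜ) Metric.isClosed_closedBall.isOpen_compl]
  · intro ζ hζ
    have hζ' : ‖q.1‖ < ‖ζ‖ := by simpa using hζ
    refine DifferentiableAt.differentiableWithinAt (DifferentiableAt.smul ?_
      (hf ζ (norm_pos_iff.1 ((norm_nonneg _).trans_lt hζ'))))
    exact (differentiableAt_id.sub_const _).inv (sub_ne_zero.2 fun h => hζ'.ne' (congrArg _ h))
  · rintro ζ ⟨-, hζ⟩ h
    have h₁ : ‖q.1‖ + 1 ≤ ‖ζ‖ := by simpa using hζ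
    have h₂ : ‖ζ‖ ≤ ‖q.1‖ := by simpa using h
    linarith

theorem eq_of_eq_comp_inv {φ ψ : ℂ → G} (hφ : Differentiable ℂ φ) (hψ : ContinuousAt ψ 0)
    (h : ∀ ξ, ξ ≠ 0 → φ ξ = ψ ξ⁻¹) (ξ : ℂ) : φ ξ = ψ 0 := by
  have ht : Tendsto φ (cocompact ℂ) (𝓝 (ψ 0)) := by
    rw [← Metric.cobounded_eq_cocompact]
    refine (hψ.tendsto.comp tendsto_inv₀_cobounded).congr' ?_
    filter_upwards [Bornology.eventually_ne_cobounded (0 : ℂ)] with ξ hξ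
    exact (h ξ hξ).symm
  rw [hφ.eq_const_of_tendsto_cocompact ht, Function.const_apply]

variable [CompleteSpace G] {Q : Type*} [NormedAddCommGroup Q] [NormedSpace ℂ Q]

theorem contDiff_laurentPlus {f : ℂ × Q → G} (hf : ∀ p : ℂ × Q, p.1 ≠ 0 → ContDiffAt ℂ ω f p) :
    ContDiff ℂ ω (laurentPlus f) := by
  refine contDiff_iff_contDiffAt.2 fun p => AnalyticAt.contDiffAt ?_
  have han : AnalyticAt ℂ
      (fun q : ℂ × Q => ∮ ζ in C(0, ‖p.1‖ + 2), (ζ - q.1)⁻¹ • f (ζ, q.2)) p := by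
    refine analyticAt_circleIntegral (F := fun x : ℂ × ℂ × Q => (x.1 - x.2.1)⁻¹ • f (x.1, x.2.2))
      (by positivity) fun ζ hζ => ?_
    have hζR : ‖ζ‖ = ‖p.1‖ + 2 := by simpa using hζ
    have hζp : ζ - p.1 ≠ 0 := sub_ne_zero.2 fun h => by simp [h] at hζR
    have hf' := (hf (ζ, p.2) (norm_pos_iff.1 (hζR ▸ by positivity))).analyticAt
    refine ((analyticAt_fst.sub (analyticAt_fst.fun_comp analyticAt_snd)).inv hζp).smul ?_
    exact hf'.comp (f := fun x : ℂ × ℂ × Q => (x.1, x.2.2))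
      (analyticAt_fst.prod (analyticAt_snd.fun_comp analyticAt_snd))
  refine (han.const_smul (c := (2 * Real.pi * Complex.I : ℂ)⁻¹)).congr ?_
  have hlt : ∀ᶠ q : ℂ × Q in 𝓝 p, ‖q.1‖ < ‖p.1‖ + 1 :=
    ContinuousAt.eventually_lt (by fun_prop) continuousAt_const (by simp)
  filter_upwards [hlt] with q hq
  exact (laurentPlus_eq (fun z hz => ((hf (z, q.2) hz).differentiableAt (by simp)).comp z
    (f := fun z => (z, q.2)) (by fun_prop)) (by linarith)).symm

theorem exists_laurent_decomposition {f : ℂ × Q → G}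
    (hf : ∀ p : ℂ × Q, p.1 ≠ 0 → ContDiffAt ℂ ω f p) :
    ∃ a b : ℂ × Q → G, ContDiff ℂ ω a ∧ ContDiff ℂ ω b ∧
      ∀ p : ℂ × Q, p.1 ≠ 0 → f p = a p + p.1⁻¹ • b (p.1⁻¹, p.2) := by
  refine ⟨laurentPlus f, laurentPlus fun p => p.1⁻¹ • f (p.1⁻¹, p.2), contDiff_laurentPlus hf,
    contDiff_laurentPlus fun p hp => ?_, ?_⟩
  · exact (contDiffAt_fst.inv hp).smul ((hf (p.1⁻¹, p.2) (inv_ne_zero hp)).comp p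
      ((contDiffAt_fst.inv hp).prodMk contDiffAt_snd))
  rintro ⟨z, q⟩ hz
  change z ≠ 0 at hz
  have hg : DifferentiableOn ℂ (fun ζ => f (ζ, q)) {0}ᶜ := fun ζ hζ =>
    (((hf (ζ, q) hζ).differentiableAt (by simp)).comp ζ (f := fun ζ => (ζ, q))
      (by fun_prop)).differentiableWithinAt
  have hr : (‖z⁻¹‖ + 1)⁻¹ < ‖z‖ := by
    rw [inv_lt_comm₀ (by positivity) (norm_pos_iff.2 hz), norm_inv]
    linarith
  have hcauchy := two_pi_I_smul_eq_circleIntegral_sub_circleIntegral (c := 0) (z := z)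
    (r := (‖z⁻¹‖ + 1)⁻¹) (R := ‖z‖ + 1) (by positivity) (by simpa using hr) (by simp)
    isOpen_compl_singleton hg ?_
  · have hinner : (∮ ζ in C(0, (‖z⁻¹‖ + 1)⁻¹), (ζ - z)⁻¹ • f (ζ, q)) =
        -(z⁻¹ • ∮ ζ in C(0, ‖z⁻¹‖ + 1), (ζ - z⁻¹)⁻¹ • ζ⁻¹ • f (ζ⁻¹, q)) := by
      rw [circleIntegral_comp_inv, ← neg_smul, ← circleIntegral.integral_smul]
      refine circleIntegral.integral_congr (by positivity) fun ζ hζ => ?_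
      have hζn : ‖ζ‖ = ‖z⁻¹‖ + 1 := by simpa using hζ
      have hζ0 : ζ ≠ 0 := norm_pos_iff.1 (hζn ▸ by positivity)
      have hζz : ζ - z⁻¹ ≠ 0 := sub_ne_zero.2 fun h => by simp [h] at hζn
      have hζz' : ζ⁻¹ - z = -(z * ζ⁻¹ * (ζ - z⁻¹)) := by field_simp; ring
      simp only [smul_smul, hζz', inv_neg, mul_inv, inv_inv]
      congr 1
      field_simp [hζz]
    rw [hinner, sub_neg_eq_add] at hcauchy
    simp only [laurentPlus]
    rw [smul_comm z⁻¹, ← smul_add, ← hcauchy, inv_smul_smul₀ Complex.two_pi_I_ne_zero]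
  · rintro ζ ⟨-, hζ⟩ rfl
    exact hζ (Metric.mem_ball_self (by positivity))

theorem exists_contDiff_eq_add_fst_smul {f : ℂ × Q → G} (hf : ContDiff ℂ ω f) :
    ∃ g : ℂ × Q → G, ContDiff ℂ ω g ∧ ∀ p, f p = f (0, p.2) + p.1 • g p := by
  obtain ⟨g, k, hg, hk, hdec⟩ := exists_laurent_decomposition (f := fun p : ℂ × Q => p.1⁻¹ • f p)
    fun p hp => (contDiffAt_fst.inv hp).smul hf.contDiffAt
  have hfg : ∀ z q, z ≠ 0 → f (z, q) - z • g (z, q) = k (z⁻¹, q) := fun z q hz => by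
    rw [← smul_right_injective G (inv_ne_zero hz) |>.eq_iff, smul_sub, inv_smul_smul₀ hz,
      sub_eq_iff_eq_add']
    exact hdec (z, q) hz
  -- By Liouville's theorem the polar part `k` does not depend on its first variable.
  have hk0 : ∀ ξ q, k (ξ, q) = f (0, q) := fun ξ q => by
    refine (eq_of_eq_comp_inv (φ := fun ξ => k (ξ, q)) (ψ := fun z => f (z, q) - z • g (z, q))
      ?_ ?_ (fun ξ hξ => ?_) ξ).trans (by rw [zero_smul, sub_zero])
    · exact (hk.differentiable (by simp)).comp (by fun_prop)
    · have hfc := hf.continuous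
      have hgc := hg.continuous
      exact Continuous.continuousAt (by fun_prop)
    · rw [hfg _ _ (inv_ne_zero hξ), inv_inv]
  refine ⟨g, hg, fun ⟨z, q⟩ => ?_⟩
  rcases eq_or_ne z 0 with rfl | hz
  · rw [zero_smul, add_zero]
  · rw [← hk0 z⁻¹ q, ← hfg z q hz, sub_add_cancel]

end Laurent

/-! ### Splitting of cocycles -/

/-- The set where the first coordinate does not vanish. -/
def punctured : Set C3 := {p | p.1 ≠ 0}

theorem isOpen_punctured : IsOpen punctured := isOpen_ne_fun continuous_fst continuous_const

/-- The closure properties, shared by the entire and by the polynomial functions on `ℂ³`, that the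
computation of `H¹(W₂, TW₂)` uses. -/
structure IsCoordinateAlgebra (R : Subalgebra ℂ (C3 → ℂ)) : Prop where
  fst_mem : (fun p => p.1) ∈ R
  snd_mem : (fun p => p.2.1) ∈ R
  thd_mem : (fun p => p.2.2) ∈ R
  comp_mem : ∀ {f a b c : C3 → ℂ}, f ∈ R → a ∈ R → b ∈ R → c ∈ R →
    (fun p => f (a p, b p, c p)) ∈ R
  exists_eq_add_fst_mul : ∀ {f : C3 → ℂ}, f ∈ R → ∃ g ∈ R, ∀ p, f p = f (0, p.2) + p.1 * g p

/-- The functions on `ℂ³ ∖ {z = 0}` that are a sum of a function in `R` and of `z⁻¹` times a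
function in `R` of `(z⁻¹, u₁, u₂)`. -/
def IsLaurentSplit (R : Subalgebra ℂ (C3 → ℂ)) (f : C3 → ℂ) : Prop :=
  ∃ a ∈ R, ∃ b ∈ R, ∀ p : C3, p.1 ≠ 0 → f p = a p + p.1⁻¹ * b (p.1⁻¹, p.2)

/-- The self-maps of `ℂ³` whose components belong to `R`. -/
def componentsIn (R : Subalgebra ℂ (C3 → ℂ)) : Set (C3 → C3) :=
  {A | (fun p => (A p).1) ∈ R ∧ (fun p => (A p).2.1) ∈ R ∧ (fun p => (A p).2.2) ∈ R}

/-- The `V`-coordinates on `W₂` in terms of the `U`-coordinates. -/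
def W2trans (p : C3) : C3 := (p.1⁻¹, p.1 ^ 2 * p.2.1, p.2.2)

/-- The components in `U`-coordinates at `p` of the tangent vector of `W₂` with components `v` in
the `V`-coordinates. -/
def W2pull (p v : C3) : C3 :=
  (-(p.1 ^ 2 * v.1), 2 * p.1 * p.2.1 * v.1 + (p.1 ^ 2)⁻¹ * v.2.1, v.2.2)

namespace IsCoordinateAlgebra

variable {R : Subalgebra ℂ (C3 → ℂ)}

theorem exists_eq_add_snd_mul (hR : IsCoordinateAlgebra R) {f : C3 → ℂ} (hf : f ∈ R) :
    ∃ g ∈ R, ∀ p, f p = f (p.1, 0, p.2.2) + p.2.1 * g p := by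
  obtain ⟨g, hg, h⟩ := hR.exists_eq_add_fst_mul
    (hR.comp_mem hf hR.snd_mem hR.fst_mem hR.thd_mem)
  exact ⟨_, hR.comp_mem hg hR.snd_mem hR.fst_mem hR.thd_mem, fun p => h (p.2.1, p.1, p.2.2)⟩

theorem isLaurentSplit_inv_pow_mul (hR : IsCoordinateAlgebra R) (n : ℕ) {f : C3 → ℂ}
    (hf : f ∈ R) : IsLaurentSplit R fun p => (p.1 ^ n)⁻¹ * f p := by
  induction n generalizing f with
  | zero => exact ⟨f, hf, 0, zero_mem R, fun p _ => by simp⟩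
  | succ n ih =>
    obtain ⟨g, hg, hfg⟩ := hR.exists_eq_add_fst_mul hf
    obtain ⟨a, ha, b, hb, hab⟩ := ih hg
    refine ⟨a, ha, _, add_mem hb (mul_mem (pow_mem hR.fst_mem n)
      (hR.comp_mem hf (zero_mem R) hR.snd_mem hR.thd_mem)), fun p hp => ?_⟩
    have hz : p.1 ≠ 0 := hp
    calc (p.1 ^ (n + 1))⁻¹ * f p
        = (p.1 ^ n)⁻¹ * g p + p.1⁻¹ * ((p.1⁻¹) ^ n * f (0, p.2)) := by
          rw [hfg p, inv_pow]
          field_simp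
          ring
      _ = a p + p.1⁻¹ * b (p.1⁻¹, p.2) + p.1⁻¹ * ((p.1⁻¹) ^ n * f (0, p.2)) := by
          rw [← hab p hp]
      _ = _ := by rw [add_assoc, ← mul_add]; rfl

theorem exists_splitting (hR : IsCoordinateAlgebra R) {σ : C3 → C3}
    (h₁ : IsLaurentSplit R fun p => (σ p).1) (h₂ : IsLaurentSplit R fun p => p.1 * (σ p).2.1)
    (h₃ : IsLaurentSplit R fun p => (σ p).2.2) :
    ∃ A ∈ componentsIn R, ∃ B ∈ componentsIn R, ∃ b ∈ R, ∀ p : C3, p.1 ≠ 0 →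
      σ p = A p - W2pull p (B (W2trans p)) + (0, p.1⁻¹ * b (0, 0, p.2.2), 0) := by
  obtain ⟨a, ha, α, hα, e₁⟩ := h₁
  obtain ⟨b, hb, β, hβ, e₂⟩ := h₂
  obtain ⟨c, hc, γ, hγ, e₃⟩ := h₃
  obtain ⟨b₁, hb₁, eb₁⟩ := hR.exists_eq_add_fst_mul hb
  obtain ⟨b₂, hb₂, eb₂⟩ := hR.exists_eq_add_snd_mul hb
  have hξ := hR.fst_mem
  have hv := hR.snd_mem
  have hu₁ : (fun q : C3 => q.1 ^ 2 * q.2.1) ∈ R := mul_mem (pow_mem hξ 2) hv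
  -- In the second component of `B`, the term with `α` cancels the entry `2 z u₁` of the Jacobian
  -- `W2pull`, and the term with `b₂` extends `z⁻¹ u₁ b₂` to `V`.
  refine ⟨fun p => (a p, b₁ p, c p), ⟨ha, hb₁, hc⟩,
    fun q => (q.1 ^ 3 * α (q.1, q.1 ^ 2 * q.2.1, q.2.2),
      (-2 : ℂ) • (q.1 ^ 2 * q.2.1 * α (q.1, q.1 ^ 2 * q.2.1, q.2.2)) -
        β (q.1, q.1 ^ 2 * q.2.1, q.2.2) - q.1 * q.2.1 * b₂ (0, q.1 ^ 2 * q.2.1, q.2.2),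
      -(q.1 * γ (q.1, q.1 ^ 2 * q.2.1, q.2.2))), ⟨?_, ?_, ?_⟩, b, hb, ?_⟩
  · exact mul_mem (pow_mem hξ 3) (hR.comp_mem hα hξ hu₁ hR.thd_mem)
  · exact sub_mem (sub_mem (R.smul_mem (mul_mem hu₁ (hR.comp_mem hα hξ hu₁ hR.thd_mem)) _)
      (hR.comp_mem hβ hξ hu₁ hR.thd_mem))
      (mul_mem (mul_mem hξ hv) (hR.comp_mem hb₂ (zero_mem R) hu₁ hR.thd_mem))
  · exact neg_mem (mul_mem hξ (hR.comp_mem hγ hξ hu₁ hR.thd_mem))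
  rintro ⟨z, u, w⟩ hz
  change z ≠ 0 at hz
  have hu : z⁻¹ ^ 2 * (z ^ 2 * u) = u := by field_simp
  have e₁ := e₁ (z, u, w) hz
  have e₂ := e₂ (z, u, w) hz
  have e₃ := e₃ (z, u, w) hz
  rw [eb₁, eb₂ (0, u, w)] at e₂
  simp only [W2pull, W2trans, hu]
  ext
  · simp only [Prod.fst_add, Prod.fst_sub, e₁]
    field_simp
    ring
  · simp only [Prod.fst_add, Prod.fst_sub, Prod.snd_add, Prod.snd_sub, smul_eq_mul]
    field_simp at e₂ ⊢
    linear_combination e₂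
  · simp only [Prod.snd_add, Prod.snd_sub, e₃]
    ring

end IsCoordinateAlgebra

/-- The holomorphic functions on `ℂ³`. -/
def holFun : Subalgebra ℂ (C3 → ℂ) where
  carrier := {f | ContDiff ℂ ω f}
  mul_mem' {_ _} (hf : ContDiff ℂ ω _) hg := hf.mul hg
  add_mem' {_ _} (hf : ContDiff ℂ ω _) hg := hf.add hg
  algebraMap_mem' r := (contDiff_const : ContDiff ℂ ω fun _ : C3 => r)

theorem mem_holFun {f : C3 → ℂ} : f ∈ holFun ↔ ContDiff ℂ ω f := Iff.rfl

theorem mem_componentsIn_holFun {A : C3 → C3} : A ∈ componentsIn holFun ↔ ContDiff ℂ ω A :=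
  ⟨fun ⟨h₁, h₂, h₃⟩ =>
    (mem_holFun.1 h₁).prodMk ((mem_holFun.1 h₂).prodMk (mem_holFun.1 h₃)),
    fun h => ⟨mem_holFun.2 h.fst, mem_holFun.2 h.snd.fst, mem_holFun.2 h.snd.snd⟩⟩

theorem isCoordinateAlgebra_holFun : IsCoordinateAlgebra holFun where
  fst_mem := mem_holFun.2 contDiff_fst
  snd_mem := mem_holFun.2 contDiff_snd.fst
  thd_mem := mem_holFun.2 contDiff_snd.snd
  comp_mem hf ha hb hc := mem_holFun.2 <| (mem_holFun.1 hf).comp <|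
    (mem_holFun.1 ha).prodMk ((mem_holFun.1 hb).prodMk (mem_holFun.1 hc))
  exists_eq_add_fst_mul hf := exists_contDiff_eq_add_fst_smul (mem_holFun.1 hf)

theorem isLaurentSplit_holFun {f : C3 → ℂ} (hf : ContDiffOn ℂ ω f punctured) :
    IsLaurentSplit holFun f := by
  obtain ⟨a, b, ha, hb, h⟩ := exists_laurent_decomposition
    fun p (hp : p.1 ≠ 0) => hf.contDiffAt (isOpen_punctured.mem_nhds hp)
  exact ⟨a, ha, b, hb, h⟩

theorem comp_mem_polyFun {f a b c : C3 → ℂ} (hf : f ∈ polyFun) (ha : a ∈ polyFun)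
    (hb : b ∈ polyFun) (hc : c ∈ polyFun) : (fun p => f (a p, b p, c p)) ∈ polyFun := by
  induction hf using Algebra.adjoin_induction with
  | mem x hx =>
    rcases hx with rfl | rfl | rfl
    exacts [ha, hb, hc]
  | algebraMap r => exact polyFun.algebraMap_mem r
  | add f g _ _ hf hg => exact add_mem hf hg
  | mul f g _ _ hf hg => exact mul_mem hf hg

theorem isCoordinateAlgebra_polyFun : IsCoordinateAlgebra polyFun where
  fst_mem := Algebra.subset_adjoin (by simp)
  snd_mem := Algebra.subset_adjoin (by simp)
  thd_mem := Algebra.subset_adjoin (by simp)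
  comp_mem := comp_mem_polyFun
  exists_eq_add_fst_mul {f} hf := by
    have hu : (fun p : C3 => p.2.1) ∈ polyFun := Algebra.subset_adjoin (by simp)
    have hw : (fun p : C3 => p.2.2) ∈ polyFun := Algebra.subset_adjoin (by simp)
    induction hf using Algebra.adjoin_induction with
    | mem x hx =>
      rcases hx with rfl | rfl | rfl
      · exact ⟨1, one_mem _, fun p => by simp⟩
      · exact ⟨0, zero_mem _, fun p => by simp⟩
      · exact ⟨0, zero_mem _, fun p => by simp⟩
    | algebraMap r => exact ⟨0, zero_mem _, fun p => by simp⟩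
    | add f g _ _ hf hg =>
      obtain ⟨f₁, hf₁, ef⟩ := hf
      obtain ⟨g₁, hg₁, eg⟩ := hg
      refine ⟨f₁ + g₁, add_mem hf₁ hg₁, fun p => ?_⟩
      simp only [Pi.add_apply]
      rw [ef p, eg p]
      ring
    | mul f g hf' hg' hf hg =>
      obtain ⟨f₁, hf₁, ef⟩ := hf
      obtain ⟨g₁, hg₁, eg⟩ := hg
      have hf₀ := comp_mem_polyFun hf' (zero_mem _) hu hw
      refine ⟨f₁ * g + _ * g₁, add_mem (mul_mem hf₁ hg') (mul_mem hf₀ hg₁), fun p => ?_⟩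
      simp only [Pi.add_apply, Pi.mul_apply, Pi.zero_apply]
      rw [ef p, eg p]
      ring

theorem exists_polynomial_eval_eq {f : C3 → ℂ} (hf : f ∈ polyFun) (z u : ℂ) :
    ∃ T : Polynomial ℂ, ∀ w, T.eval w = f (z, u, w) := by
  induction hf using Algebra.adjoin_induction with
  | mem x hx =>
    rcases hx with rfl | rfl | rfl
    · exact ⟨Polynomial.C z, fun w => Polynomial.eval_C⟩
    · exact ⟨Polynomial.C u, fun w => Polynomial.eval_C⟩
    · exact ⟨Polynomial.X, fun w => Polynomial.eval_X⟩
  | algebraMap r => exact ⟨Polynomial.C r, fun w => Polynomial.eval_C⟩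
  | add f g _ _ hf hg =>
    obtain ⟨S, hS⟩ := hf
    obtain ⟨T, hT⟩ := hg
    exact ⟨S + T, fun w => by rw [Polynomial.eval_add, hS, hT, Pi.add_apply]⟩
  | mul f g _ _ hf hg =>
    obtain ⟨S, hS⟩ := hf
    obtain ⟨T, hT⟩ := hg
    exact ⟨S * T, fun w => by rw [Polynomial.eval_mul, hS, hT, Pi.mul_apply]⟩

theorem polyFun_le_holFun : polyFun ≤ holFun :=
  Algebra.adjoin_le <| by
    rintro _ (rfl | rfl | rfl)
    exacts [isCoordinateAlgebra_holFun.fst_mem, isCoordinateAlgebra_holFun.snd_mem,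
      isCoordinateAlgebra_holFun.thd_mem]

theorem eq_zero_of_splitting {A B : C3 → C3} {T : ℂ → ℂ} (hA : ContDiff ℂ ω A)
    (hB : ContDiff ℂ ω B)
    (h : ∀ p : C3, p.1 ≠ 0 → (0, p.1⁻¹ * T p.2.2, 0) = A p - W2pull p (B (W2trans p))) (w : ℂ) :
    T w = 0 := by
  have hz : ∀ z : ℂ, z ≠ 0 →
      z * (A (z, 0, w)).2.1 - T w = z⁻¹ * (B (z⁻¹, 0, w)).2.1 := fun z hz => by
    have := congrArg (fun p : C3 => p.2.1) (h (z, 0, w) hz)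
    simp only [W2pull, W2trans, Prod.fst_sub, Prod.snd_sub, mul_zero, zero_mul, zero_add] at this
    field_simp at this ⊢
    linear_combination -this
  have hA' : Differentiable ℂ fun z => z * (A (z, 0, w)).2.1 - T w := by
    have := hA.differentiable (by simp)
    fun_prop
  have hB' : Continuous fun ξ => ξ * (B (ξ, 0, w)).2.1 := by
    have := hB.continuous
    fun_prop
  simpa using eq_of_eq_comp_inv hA' hB'.continuousAt hz 0

/-! ### Entire functions and Taylor coefficients -/

theorem hasFPowerSeriesOnBall_entireSum (t : Param) :
    HasFPowerSeriesOnBall (entireSum t) (FormalMultilinearSeries.ofScalars ℂ t.1) 0 ⊤ := by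
  have hr : (FormalMultilinearSeries.ofScalars ℂ t.1).radius = ⊤ :=
    FormalMultilinearSeries.radius_eq_top_of_summable_norm _ fun r => by
      simpa using (t.2 (r : ℂ)).norm
  have := (FormalMultilinearSeries.ofScalars ℂ t.1).hasFPowerSeriesOnBall (by simp [hr])
  rw [hr] at this
  refine this.congr fun w _ => ?_
  change FormalMultilinearSeries.ofScalarsSum t.1 w = _
  rw [FormalMultilinearSeries.ofScalars_sum_eq]
  simp [entireSum]

theorem contDiff_entireSum (t : Param) : ContDiff ℂ ω (entireSum t) := by
  rw [← contDiffOn_univ]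
  refine AnalyticOnNhd.contDiffOn (fun w _ => ?_) uniqueDiffOn_univ
  exact (hasFPowerSeriesOnBall_entireSum t).analyticAt_of_mem (by simp)

/-- The sequence `t` is sent to the entire function `∑ⱼ tⱼ wʲ`, linearly in `t`. -/
def entireSumLin : Param →ₗ[ℂ] ℂ → ℂ where
  toFun := entireSum
  map_add' s t := funext fun w => by
    simp only [entireSum, Submodule.coe_add, Pi.add_apply, add_mul]
    exact (s.2 w).tsum_add (t.2 w)
  map_smul' c t := funext fun w => by
    simp only [entireSum, Submodule.coe_smul, Pi.smul_apply, smul_eq_mul, mul_assoc]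
    exact tsum_mul_left

theorem entireSum_smul (c : ℂ) (t : Param) (w : ℂ) : entireSum (c • t) w = c * entireSum t w :=
  congrFun (entireSumLin.map_smul c t) w

theorem entireSum_zero (w : ℂ) : entireSum 0 w = 0 := congrFun entireSumLin.map_zero w

theorem entireSumLin_injective : Function.Injective entireSumLin := by
  refine (injective_iff_map_eq_zero entireSumLin).2 fun t (ht : entireSum t = 0) => ?_
  have h := (hasFPowerSeriesOnBall_entireSum t).hasFPowerSeriesAt
  rw [ht] at h
  exact Subtype.ext ((FormalMultilinearSeries.ofScalars_series_eq_zero ℂ).1 h.eq_zero)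

theorem exists_entireSum_eq {T : ℂ → ℂ} (hT : Differentiable ℂ T) :
    ∃ t : Param, entireSum t = T := by
  let c : ℕ → ℂ := fun j => (j.factorial : ℂ)⁻¹ * iteratedDeriv j T 0
  have h : ∀ w, HasSum (fun j => c j * w ^ j) (T w) := by
    intro w
    have h := Complex.hasSum_taylorSeries_of_entire hT 0 w
    simp only [sub_zero, smul_eq_mul] at h
    refine h.congr_fun fun j => ?_
    ring
  exact ⟨⟨c, fun w => (h w).summable⟩, funext fun w => (h w).tsum_eq⟩

theorem linearIndependent_single : LinearIndependent ℂ Param.single :=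
  .of_comp Param.subtype (Pi.linearIndependent_single_one ℕ ℂ)

section Parametrization

variable {𝕜 : Type*} [NontriviallyNormedField 𝕜]
  {F : Type*} [NormedAddCommGroup F] [NormedSpace 𝕜 F]
  {M : Type*} [TopologicalSpace M] [ChartedSpace F M]
  {F' : Type*} [NormedAddCommGroup F'] [NormedSpace 𝕜 F']
  {H' : Type*} [TopologicalSpace H'] {I' : ModelWithCorners 𝕜 F' H'}
  {N : Type*} [TopologicalSpace N] [ChartedSpace H' N]
  {F'' : Type*} [NormedAddCommGroup F''] [NormedSpace 𝕜 F'']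
  {n : WithTop ℕ∞}

variable (𝕜) in
/-- `j : F → M` is the inverse of a chart `e` of `M` whose image is the whole model space. -/
structure IsChartInverse (j : F → M) (e : OpenPartialHomeomorph M F) : Prop where
  mem : e ∈ IsManifold.maximalAtlas 𝓘(𝕜, F) ω M
  source : e.source = range j
  left_inv : ∀ p, e (j p) = p

namespace IsChartInverse

variable {j : F → M} {e : OpenPartialHomeomorph M F} (h : IsChartInverse 𝕜 j e)
include h

theorem apply_chart {x : M} (hx : x ∈ range j) : j (e x) = x := by
  obtain ⟨p, rfl⟩ := hx
  rw [h.left_inv]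

theorem mem_source (p : F) : j p ∈ e.source := h.source ▸ mem_range_self p

theorem symm_eq : ⇑e.symm = j := by
  ext p
  rw [← e.left_inv (h.mem_source p), h.left_inv]

theorem target : e.target = univ :=
  eq_univ_of_forall fun p => h.left_inv p ▸ e.map_source (h.mem_source p)

theorem isOpen_range : IsOpen (range j) := h.source ▸ e.open_source

theorem contMDiffOn_chart : ContMDiffOn 𝓘(𝕜, F) 𝓘(𝕜, F) ω e (range j) :=
  h.source ▸ contMDiffOn_of_mem_maximalAtlas h.mem

theorem contMDiff : ContMDiff 𝓘(𝕜, F) 𝓘(𝕜, F) ω j := by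
  have := contMDiffOn_symm_of_mem_maximalAtlas h.mem
  rwa [h.target, h.symm_eq, contMDiffOn_univ] at this

theorem mdifferentiableAt (p : F) : MDifferentiableAt 𝓘(𝕜, F) 𝓘(𝕜, F) j p :=
  h.contMDiff.mdifferentiable (by simp) p

theorem contMDiffAt_chart (p : F) : ContMDiffAt 𝓘(𝕜, F) 𝓘(𝕜, F) ω e (j p) :=
  h.contMDiffOn_chart.contMDiffAt (h.isOpen_range.mem_nhds (mem_range_self p))

theorem mdifferentiableAt_chart (p : F) : MDifferentiableAt 𝓘(𝕜, F) 𝓘(𝕜, F) e (j p) :=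
  (h.contMDiffAt_chart p).mdifferentiableAt (by simp)

theorem mfderiv_chart_apply (p v : F) :
    mfderiv 𝓘(𝕜, F) 𝓘(𝕜, F) e (j p) (mfderiv 𝓘(𝕜, F) 𝓘(𝕜, F) j p v) = v := by
  have h_chain := mfderiv_comp p (h.mdifferentiableAt_chart p) (h.mdifferentiableAt p)
  have h_comp : e ∘ j = id := funext h.left_inv
  rw [h_comp, mfderiv_id] at h_chain
  exact (congrArg (fun T : F →L[𝕜] F => T v) h_chain).symm

theorem mfderiv_apply_chart (p : F) (v : TangentSpace 𝓘(𝕜, F) (j p)) :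
    mfderiv 𝓘(𝕜, F) 𝓘(𝕜, F) j p (mfderiv 𝓘(𝕜, F) 𝓘(𝕜, F) e (j p) v) = v := by
  have hj : MDifferentiableAt 𝓘(𝕜, F) 𝓘(𝕜, F) j (e (j p)) := h.mdifferentiableAt _
  have h_chain := mfderiv_comp (j p) hj (h.mdifferentiableAt_chart p)
  have h_comp : j ∘ e =ᶠ[𝓝 (j p)] id := by
    filter_upwards [h.isOpen_range.mem_nhds (mem_range_self p)] with x hx
    exact h.apply_chart hx
  rw [h_comp.mfderiv_eq, mfderiv_id, h.left_inv] at h_chain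
  exact (congrArg (fun T : F →L[𝕜] F => T v) h_chain).symm

theorem mfderiv_injective (p : F) : Function.Injective (mfderiv 𝓘(𝕜, F) 𝓘(𝕜, F) j p) :=
  fun v w hvw => (h.mfderiv_chart_apply p v).symm.trans <|
    (congrArg (fun x => mfderiv 𝓘(𝕜, F) 𝓘(𝕜, F) e (j p) x) hvw).trans (h.mfderiv_chart_apply p w)

theorem contMDiffOn_image_iff {f : M → N} {s : Set F} (hs : IsOpen s) :
    ContMDiffOn 𝓘(𝕜, F) I' n f (j '' s) ↔ ContMDiffOn 𝓘(𝕜, F) I' n (f ∘ j) s := by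
  constructor
  · intro hf
    exact hf.comp (h.contMDiff.of_le le_top).contMDiffOn fun p hp => mem_image_of_mem j hp
  · rintro hf _ ⟨p, hp, rfl⟩
    have hf_chart : ContMDiffAt 𝓘(𝕜, F) I' n (f ∘ j) (e (j p)) := by
      rw [h.left_inv]
      exact hf.contMDiffAt (hs.mem_nhds hp)
    have h_comp := hf_chart.comp (j p) ((h.contMDiffAt_chart p).of_le le_top)
    refine (h_comp.congr_of_eventuallyEq ?_).contMDiffWithinAt
    filter_upwards [h.isOpen_range.mem_nhds (mem_range_self p)] with x hx
    simp only [Function.comp_apply, h.apply_chart hx]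

theorem contMDiffOn_range_iff {f : M → N} :
    ContMDiffOn 𝓘(𝕜, F) I' n f (range j) ↔ ContMDiff 𝓘(𝕜, F) I' n (f ∘ j) := by
  rw [← image_univ, h.contMDiffOn_image_iff isOpen_univ, contMDiffOn_univ]

variable [IsManifold 𝓘(𝕜, F) ω M]

theorem contDiffOn_components {c : F'' → F} {a : (p : F'') → TangentSpace 𝓘(𝕜, F) (j (c p))}
    {s : Set F''}
    (ha : ContMDiffOn 𝓘(𝕜, F'') 𝓘(𝕜, F).tangent ω
      (fun p => (⟨j (c p), a p⟩ : TangentBundle 𝓘(𝕜, F) M)) s) :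
    ContDiffOn 𝕜 ω (fun p => (mfderiv 𝓘(𝕜, F) 𝓘(𝕜, F) e (j (c p)) (a p) : F)) s := by
  have : IsManifold 𝓘(𝕜, F) 1 M := IsManifold.of_le (n := ω) le_top
  have h_tangent := h.contMDiffOn_chart.contMDiffOn_tangentMapWithin (m := ω) le_top
    h.isOpen_range.uniqueMDiffOn
  have h_comp := h_tangent.comp ha fun p _ => mem_range_self (c p)
  have h_snd := (contMDiff_snd_tangentBundle_modelSpace F 𝓘(𝕜, F) (n := ω)).comp_contMDiffOn h_comp
  refine (contMDiffOn_iff_contDiffOn.1 h_snd).congr fun p _ => ?_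
  have hm : j (c p) ∈ range j := mem_range_self _
  change _ = mfderivWithin 𝓘(𝕜, F) 𝓘(𝕜, F) e (range j) (j (c p)) (a p)
  rw [mfderivWithin_of_isOpen h.isOpen_range hm]

theorem contMDiffOn_of_components {c α : F'' → F} {s : Set F''} (hc : ContDiffOn 𝕜 ω c s)
    (hα : ContDiffOn 𝕜 ω α s) :
    ContMDiffOn 𝓘(𝕜, F'') 𝓘(𝕜, F).tangent ω
      (fun p => (⟨j (c p), mfderiv 𝓘(𝕜, F) 𝓘(𝕜, F) j (c p) (α p)⟩ :
        TangentBundle 𝓘(𝕜, F) M)) s := by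
  have : IsManifold 𝓘(𝕜, F) 1 M := IsManifold.of_le (n := ω) le_top
  have h_tangent : ContMDiff 𝓘(𝕜, F).tangent 𝓘(𝕜, F).tangent ω (tangentMap 𝓘(𝕜, F) 𝓘(𝕜, F) j) :=
    h.contMDiff.contMDiff_tangentMap le_top
  have h_section : ContMDiffOn 𝓘(𝕜, F'') 𝓘(𝕜, F).tangent ω
      (fun p => (⟨c p, α p⟩ : TangentBundle 𝓘(𝕜, F) F)) s := fun p hp => by
    refine Bundle.contMDiffWithinAt_totalSpace.2 ⟨hc.contMDiffOn p hp, ?_⟩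
    refine (hα.contMDiffOn p hp).congr (fun q _ => ?_) ?_ <;> simp
  exact h_tangent.comp_contMDiffOn h_section

end IsChartInverse

end Parametrization

namespace Glued

variable {𝕜 : Type*} [NontriviallyNormedField 𝕜] {F : Type*} [NormedAddCommGroup F]
  {g : OpenPartialHomeomorph F F}

theorem isChartInverse_inU [NormedSpace 𝕜 F]
    [IsManifold 𝓘(𝕜, F) ω (Glued g)] :
    IsChartInverse 𝕜 (inU : F → Glued g) (chartU g) where
  mem := IsManifold.subset_maximalAtlas (by simp [atlas, ChartedSpace.atlas])
  source := chartU_source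
  left_inv := chartU_inU

theorem isChartInverse_inV [NormedSpace 𝕜 F]
    [IsManifold 𝓘(𝕜, F) ω (Glued g)] :
    IsChartInverse 𝕜 (inV : F → Glued g) (chartV g) where
  mem := IsManifold.subset_maximalAtlas (by simp [atlas, ChartedSpace.atlas])
  source := chartV_source
  left_inv := chartV_inV

theorem inV_transition {F : Type*} [TopologicalSpace F] {g : OpenPartialHomeomorph F F} {p : F}
    (hp : p ∈ g.source) : (inV (g p) : Glued g) = inU p :=
  (inU_eq_inV_iff.2 ⟨hp, rfl⟩).symm

theorem mfderiv_inV [NormedSpace 𝕜 F] [IsManifold 𝓘(𝕜, F) ω (Glued g)] {p v v' : F}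
    (hp : p ∈ g.source) (hd : DifferentiableAt 𝕜 g.symm (g p))
    (hg : HasLineDerivAt 𝕜 g.symm v' (g p) v) :
    (mfderiv 𝓘(𝕜, F) 𝓘(𝕜, F) (inV : F → Glued g) (g p) v : F) =
      (mfderiv 𝓘(𝕜, F) 𝓘(𝕜, F) (inU : F → Glued g) p v' : F) := by
  have hv : fderiv 𝕜 g.symm (g p) v = v' := hd.lineDeriv_eq_fderiv.symm.trans hg.lineDeriv
  have h_eq : (inV : F → Glued g) =ᶠ[𝓝 (g p)] inU ∘ g.symm := by
    filter_upwards [g.open_target.mem_nhds (g.map_source hp)] with q hq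
    rw [Function.comp_apply, ← inV_transition (g.map_target hq), g.right_inv hq]
  have h_chain := mfderiv_comp (g p)
    ((isChartInverse_inU (𝕜 := 𝕜) (g := g)).mdifferentiableAt (g.symm (g p)))
    hd.mdifferentiableAt
  rw [h_eq.mfderiv_eq, h_chain, mfderiv_eq_fderiv]
  change (mfderiv 𝓘(𝕜, F) 𝓘(𝕜, F) (inU : F → Glued g) (g.symm (g p))
    (fderiv 𝕜 g.symm (g p) v) : F) = _
  rw [hv, g.left_inv hp]

end Glued

theorem totTransition_W2_apply (p : C3) : totTransition (-2) (2 - 2) p = W2trans p := by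
  change (p.1⁻¹, p.1 ^ (- -2 : ℤ) * p.2.1, p.1 ^ (-(2 - 2) : ℤ) * p.2.2) = _
  simp [W2trans]

theorem totTransition_W2_symm_apply (p : C3) : (totTransition (-2) (2 - 2)).symm p = W2trans p :=
  totTransition_W2_apply p

theorem hasLineDerivAt_totTransition_W2_symm {p : C3} (hp : p.1 ≠ 0) (v : C3) :
    HasLineDerivAt ℂ (totTransition (-2) (2 - 2)).symm (W2pull p v) (W2trans p) v := by
  obtain ⟨z, u, w⟩ := p
  obtain ⟨a, b, c⟩ := v
  change z ≠ 0 at hp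
  have h_line : ∀ x y : ℂ, HasDerivAt (fun s : ℂ => x + s * y) y 0 := fun x y => by
    simpa using ((hasDerivAt_id (0 : ℂ)).mul_const y).const_add x
  have h₁ := (h_line z⁻¹ a).inv (by simpa using hp)
  have h₂ := ((h_line z⁻¹ a).pow 2).mul (h_line (z ^ 2 * u) b)
  have h := h₁.prodMk (h₂.prodMk (h_line w c))
  refine (h.congr_deriv ?_).congr_of_eventuallyEq (.of_forall fun s => ?_)
  · simp only [W2pull, zero_mul, add_zero, Prod.mk.injEq, and_true, Pi.pow_apply]
    constructor <;> push_cast <;> field_simp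
  · exact totTransition_W2_symm_apply _

namespace Tot

/-- The inclusion of the chart domain `U` in `W₂`. -/
abbrev inU : C3 → W 2 := Glued.inU

/-- The inclusion of the chart domain `V` in `W₂`. -/
abbrev inV : C3 → W 2 := Glued.inV

theorem isChartInverse_inU : IsChartInverse ℂ inU (Glued.chartU _) := Glued.isChartInverse_inU

theorem isChartInverse_inV : IsChartInverse ℂ inV (Glued.chartV _) := Glued.isChartInverse_inV

theorem inV_W2trans {p : C3} (hp : p.1 ≠ 0) : inV (W2trans p) = inU p := by
  rw [← totTransition_W2_apply]
  exact Glued.inV_transition hp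

theorem mfderiv_inV {p : C3} (hp : p.1 ≠ 0) (v : C3) :
    (mfderiv 𝓘(ℂ, C3) 𝓘(ℂ, C3) inV (W2trans p) v : C3) =
      (mfderiv 𝓘(ℂ, C3) 𝓘(ℂ, C3) inU p (W2pull p v) : C3) := by
  have hd : DifferentiableAt ℂ (totTransition (-2) (2 - 2)).symm (W2trans p) :=
    ((totTransition_contDiffOn (-2) (2 - 2)).contDiffAt
      (isOpen_punctured.mem_nhds (inv_ne_zero hp))).differentiableAt (by simp)
  have h := hasLineDerivAt_totTransition_W2_symm hp v
  rw [← totTransition_W2_apply] at hd h ⊢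
  exact Glued.mfderiv_inV hp hd h

theorem W2U_inter_W2V : W2U ∩ W2V = inU '' punctured := by
  ext x
  constructor
  · rintro ⟨⟨p, rfl⟩, ⟨q, hq⟩⟩
    exact ⟨p, (Glued.inU_eq_inV_iff.1 hq.symm).1, rfl⟩
  · rintro ⟨p, hp, rfl⟩
    exact ⟨⟨p, rfl⟩, ⟨W2trans p, inV_W2trans hp⟩⟩

theorem inU_mem_inter {p : C3} (hp : p.1 ≠ 0) : inU p ∈ W2U ∩ W2V :=
  W2U_inter_W2V ▸ mem_image_of_mem inU hp

/-- The vector field on `U` with given components in the `U`-coordinates, extended arbitrarily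
to `W₂`. -/
def fieldU : (C3 → C3) →ₗ[ℂ] VField (F := C3) (W 2) where
  toFun A x := (mfderiv 𝓘(ℂ, C3) 𝓘(ℂ, C3) inU (Glued.chartU _ x) (A (Glued.chartU _ x)) : C3)
  map_add' _ _ := funext fun x =>
    map_add (mfderiv 𝓘(ℂ, C3) 𝓘(ℂ, C3) inU (Glued.chartU _ x)) _ _
  map_smul' _ _ := funext fun x =>
    map_smul (mfderiv 𝓘(ℂ, C3) 𝓘(ℂ, C3) inU (Glued.chartU _ x)) _ _

/-- The vector field on `V` with given components in the `V`-coordinates, extended arbitrarily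
to `W₂`. -/
def fieldV (B : C3 → C3) : VField (F := C3) (W 2) := fun x =>
  (mfderiv 𝓘(ℂ, C3) 𝓘(ℂ, C3) inV (Glued.chartV _ x) (B (Glued.chartV _ x)) : C3)

theorem fieldU_inU (A : C3 → C3) (p : C3) :
    fieldU A (inU p) = mfderiv 𝓘(ℂ, C3) 𝓘(ℂ, C3) inU p (A p) :=
  congrArg (fun q => (mfderiv 𝓘(ℂ, C3) 𝓘(ℂ, C3) inU q (A q) : C3)) (Glued.chartU_inU p)

theorem fieldV_inV (B : C3 → C3) (p : C3) :
    fieldV B (inV p) = mfderiv 𝓘(ℂ, C3) 𝓘(ℂ, C3) inV p (B p) :=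
  congrArg (fun q => (mfderiv 𝓘(ℂ, C3) 𝓘(ℂ, C3) inV q (B q) : C3)) (Glued.chartV_inV p)

theorem hasCoords_fieldU (σ : C3 → C3) : HasCoords (fieldU σ) σ := fun p _ => fieldU_inU σ p

theorem mem_holVField_image_iff {j : C3 → W 2} {e : OpenPartialHomeomorph (W 2) C3}
    (h : IsChartInverse ℂ j e) {s : VField (F := C3) (W 2)} {O : Set C3} (hO : IsOpen O) :
    s ∈ holVField (F := C3) (j '' O) ↔ ∃ A : C3 → C3, ContDiffOn ℂ ω A O ∧
      ∀ p ∈ O, s (j p) = mfderiv 𝓘(ℂ, C3) 𝓘(ℂ, C3) j p (A p) := by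
  have h_comp : s ∈ holVField (F := C3) (j '' O) ↔ ContMDiffOn 𝓘(ℂ, C3) 𝓘(ℂ, C3).tangent ω
      (fun p => (⟨j p, s (j p)⟩ : TangentBundle 𝓘(ℂ, C3) (W 2))) O :=
    h.contMDiffOn_image_iff hO
  rw [h_comp]
  constructor
  · intro hs
    exact ⟨_, h.contDiffOn_components (c := fun p => p) hs,
      fun p _ => (h.mfderiv_apply_chart p (s (j p))).symm⟩
  · rintro ⟨A, hA, hs⟩
    refine (h.contMDiffOn_of_components (c := fun p => p) contDiffOn_id hA).congr fun p hp => ?_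
    rw [hs p hp]

theorem mem_holVField_range_iff {j : C3 → W 2} {e : OpenPartialHomeomorph (W 2) C3}
    (h : IsChartInverse ℂ j e) {s : VField (F := C3) (W 2)} :
    s ∈ holVField (F := C3) (range j) ↔ ∃ A ∈ componentsIn holFun,
      ∀ p, s (j p) = mfderiv 𝓘(ℂ, C3) 𝓘(ℂ, C3) j p (A p) := by
  rw [← image_univ, mem_holVField_image_iff h isOpen_univ]
  simp only [mem_componentsIn_holFun, contDiffOn_univ, mem_univ, true_imp_iff]

theorem mem_holVField_inter_iff {s : VField (F := C3) (W 2)} :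
    s ∈ holVField (F := C3) (W2U ∩ W2V) ↔
      ∃ σ : C3 → C3, ContDiffOn ℂ ω σ punctured ∧ HasCoords s σ := by
  rw [W2U_inter_W2V]
  exact mem_holVField_image_iff isChartInverse_inU isOpen_punctured

end Tot

namespace HasCoords

variable {s t : VField (F := C3) (W 2)} {σ τ : C3 → C3}

theorem eq (hσ : HasCoords s σ) (hτ : HasCoords s τ) {p : C3} (hp : p.1 ≠ 0) : σ p = τ p :=
  Tot.isChartInverse_inU.mfderiv_injective p ((hσ p hp).symm.trans (hτ p hp))

theorem sub (hσ : HasCoords s σ) (hτ : HasCoords t τ) : HasCoords (s - t) (σ - τ) := fun p hp => by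
  rw [Pi.sub_apply, hσ p hp, hτ p hp]
  exact (map_sub (mfderiv 𝓘(ℂ, C3) 𝓘(ℂ, C3) Tot.inU p) (σ p) (τ p)).symm

theorem of_inU (hs : ∀ p, s (Tot.inU p) = mfderiv 𝓘(ℂ, C3) 𝓘(ℂ, C3) Tot.inU p (σ p)) :
    HasCoords s σ := fun p _ => hs p

theorem of_inV {B : C3 → C3}
    (hs : ∀ p, s (Tot.inV p) = mfderiv 𝓘(ℂ, C3) 𝓘(ℂ, C3) Tot.inV p (B p)) :
    HasCoords s fun p => W2pull p (B (W2trans p)) := fun p hp => by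
  have h : (s (Tot.inV (W2trans p)) : C3) = s (Tot.inU p) :=
    congrArg (fun x => (s x : C3)) (Tot.inV_W2trans hp)
  exact h.symm.trans ((hs _).trans (Tot.mfderiv_inV hp _))

end HasCoords

/-- `SU`, `SV` and `S` are spaces of vector fields over `U`, `V` and `U ∩ V` whose components
belong to the algebra `R` of functions on `ℂ³`. On `U ∩ V` the second component is multiplied by
`z` first, so that it is split between its powers `z⁻¹` and `z⁻²`: the powers from `z⁻²` down are
those that extend to `V`. -/
structure IsTangentCochains (R : Subalgebra ℂ (C3 → ℂ))
    (SU SV S : Submodule ℂ (VField (F := C3) (W 2))) : Prop where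
  mem_U_iff : ∀ {s}, s ∈ SU ↔ ∃ A ∈ componentsIn R,
    ∀ p, s (Tot.inU p) = mfderiv 𝓘(ℂ, C3) 𝓘(ℂ, C3) Tot.inU p (A p)
  mem_V_iff : ∀ {s}, s ∈ SV ↔ ∃ B ∈ componentsIn R,
    ∀ p, s (Tot.inV p) = mfderiv 𝓘(ℂ, C3) 𝓘(ℂ, C3) Tot.inV p (B p)
  exists_isLaurentSplit : ∀ {s}, s ∈ S → ∃ σ, HasCoords s σ ∧
    IsLaurentSplit R (fun p => (σ p).1) ∧ IsLaurentSplit R (fun p => p.1 * (σ p).2.1) ∧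
    IsLaurentSplit R fun p => (σ p).2.2

/-- The components `(0, z⁻¹ T(u₂), 0)` of a vector field on `U ∩ V`. -/
def cocycle : (ℂ → ℂ) →ₗ[ℂ] C3 → C3 where
  toFun T p := (0, p.1⁻¹ * T p.2.2, 0)
  map_add' S T := by
    ext p <;> simp [mul_add]
  map_smul' c T := by
    ext p <;> simp [mul_left_comm]

theorem cocycle_apply (T : ℂ → ℂ) (p : C3) : cocycle T p = (0, p.1⁻¹ * T p.2.2, 0) := rfl

namespace IsTangentCochains

open Tot

variable {R : Subalgebra ℂ (C3 → ℂ)} {SU SV S : Submodule ℂ (VField (F := C3) (W 2))}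

theorem mem_coboundaries_iff (h : IsTangentCochains R SU SV S) {s : VField (F := C3) (W 2)}
    {σ : C3 → C3} (hs : HasCoords s σ) :
    s ∈ coboundaries SU SV (W2U ∩ W2V) ↔ ∃ A ∈ componentsIn R, ∃ B ∈ componentsIn R,
      ∀ p : C3, p.1 ≠ 0 → σ p = A p - W2pull p (B (W2trans p)) := by
  constructor
  · rintro ⟨a, ha, b, hb, hab⟩
    obtain ⟨A, hA, ha⟩ := h.mem_U_iff.1 ha
    obtain ⟨B, hB, hb⟩ := h.mem_V_iff.1 hb
    refine ⟨A, hA, B, hB, fun p hp => ?_⟩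
    refine hs.eq (τ := A - fun p => W2pull p (B (W2trans p))) (fun p hp => ?_) hp
    rw [hab _ (inU_mem_inter hp)]
    exact (HasCoords.of_inU ha).sub (HasCoords.of_inV hb) p hp
  · rintro ⟨A, hA, B, hB, hAB⟩
    refine ⟨fieldU A, h.mem_U_iff.2 ⟨A, hA, fieldU_inU A⟩,
      fieldV B, h.mem_V_iff.2 ⟨B, hB, fieldV_inV B⟩, ?_⟩
    rw [W2U_inter_W2V]
    rintro _ ⟨p, hp, rfl⟩
    rw [hs p hp, hAB p hp]
    exact ((hasCoords_fieldU A).sub (HasCoords.of_inV (fieldV_inV B)) p hp).symm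

theorem mk_eq_mk_iff (h : IsTangentCochains R SU SV S) {θ θ' : S} {σ σ' : C3 → C3}
    (hθ : HasCoords θ.1 σ) (hθ' : HasCoords θ'.1 σ') :
    (Submodule.Quotient.mk θ : CechH1 SU SV S (W2U ∩ W2V)) = Submodule.Quotient.mk θ' ↔
      ∃ A ∈ componentsIn R, ∃ B ∈ componentsIn R,
        ∀ p : C3, p.1 ≠ 0 → σ p = A p - W2pull p (B (W2trans p)) + σ' p := by
  rw [Submodule.Quotient.eq]
  change θ.1 - θ'.1 ∈ coboundaries SU SV (W2U ∩ W2V) ↔ _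
  simp only [h.mem_coboundaries_iff (hθ.sub hθ'), Pi.sub_apply, sub_eq_iff_eq_add]

variable {P : Type*} [AddCommGroup P] [Module ℂ P] {ev : P →ₗ[ℂ] ℂ → ℂ} {κ : P →ₗ[ℂ] S}

theorem injective_mkQ_comp (h : IsTangentCochains R SU SV S) (hR : R ≤ holFun)
    (hκ : ∀ t, HasCoords (κ t).1 (cocycle (ev t))) (hev : Function.Injective ev) :
    Function.Injective
      (Submodule.mkQ _ ∘ₗ κ : P →ₗ[ℂ] CechH1 SU SV S (W2U ∩ W2V)) := by
  refine (injective_iff_map_eq_zero _).2 fun t ht => ?_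
  have ht' : (κ t).1 ∈ coboundaries SU SV (W2U ∩ W2V) := by
    rwa [LinearMap.comp_apply, Submodule.mkQ_apply, Submodule.Quotient.mk_eq_zero] at ht
  obtain ⟨A, hA, B, hB, hAB⟩ := (h.mem_coboundaries_iff (hκ t)).1 ht'
  have h_hol : ∀ {A : C3 → C3}, A ∈ componentsIn R → ContDiff ℂ ω A := fun hA =>
    mem_componentsIn_holFun.1 ⟨hR hA.1, hR hA.2.1, hR hA.2.2⟩
  refine (injective_iff_map_eq_zero ev).1 hev t (funext ?_)
  exact eq_zero_of_splitting (h_hol hA) (h_hol hB) hAB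

theorem surjective_mkQ_comp (h : IsTangentCochains R SU SV S) (hR : IsCoordinateAlgebra R)
    (hκ : ∀ t, HasCoords (κ t).1 (cocycle (ev t)))
    (hev : ∀ b ∈ R, ∃ t, ev t = fun w => b (0, 0, w)) :
    Function.Surjective
      (Submodule.mkQ _ ∘ₗ κ : P →ₗ[ℂ] CechH1 SU SV S (W2U ∩ W2V)) := by
  intro c
  obtain ⟨θ, rfl⟩ := Submodule.Quotient.mk_surjective _ c
  obtain ⟨σ, hθ, h₁, h₂, h₃⟩ := h.exists_isLaurentSplit θ.2
  obtain ⟨A, hA, B, hB, b, hb, hσ⟩ := hR.exists_splitting h₁ h₂ h₃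
  obtain ⟨t, ht⟩ := hev b hb
  refine ⟨t, ((h.mk_eq_mk_iff hθ (hκ t)).2 ⟨A, hA, B, hB, fun p hp => ?_⟩).symm⟩
  rw [hσ p hp, cocycle_apply, ht]

end IsTangentCochains

namespace Tot

theorem isTangentCochains_hol : IsTangentCochains holFun (holVField (F := C3) W2U)
    (holVField (F := C3) W2V) (holVField (F := C3) (W2U ∩ W2V)) where
  mem_U_iff := mem_holVField_range_iff isChartInverse_inU
  mem_V_iff := mem_holVField_range_iff isChartInverse_inV
  exists_isLaurentSplit hs := by
    obtain ⟨σ, hσ, hsσ⟩ := mem_holVField_inter_iff.1 hs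
    exact ⟨σ, hsσ, isLaurentSplit_holFun hσ.fst,
      isLaurentSplit_holFun (contDiffOn_fst.mul hσ.snd.fst), isLaurentSplit_holFun hσ.snd.snd⟩

theorem isTangentCochains_alg : IsTangentCochains polyFun algU algV algUV where
  mem_U_iff := Iff.rfl
  mem_V_iff := Iff.rfl
  exists_isLaurentSplit := by
    rintro s ⟨n, P, hP, hs⟩
    have h := isCoordinateAlgebra_polyFun
    refine ⟨_, hs, h.isLaurentSplit_inv_pow_mul n hP.1, ?_, h.isLaurentSplit_inv_pow_mul n hP.2.2⟩
    convert h.isLaurentSplit_inv_pow_mul n (mul_mem h.fst_mem hP.2.1) using 2 with p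
    exact mul_left_comm _ _ _

theorem contDiffOn_cocycle {T : ℂ → ℂ} (hT : ContDiff ℂ ω T) :
    ContDiffOn ℂ ω (cocycle T) punctured :=
  contDiffOn_const.prodMk (((contDiffOn_fst.inv fun _ hp => hp).mul
    (hT.comp contDiff_snd.snd).contDiffOn).prodMk contDiffOn_const)

/-- The vector field `(0, z⁻¹ ∑ⱼ tⱼ u₂ʲ, 0)`, holomorphic on `U ∩ V`. -/
def holCocycle : Param →ₗ[ℂ] holVField (F := C3) (W2U ∩ W2V) :=
  (fieldU ∘ₗ cocycle ∘ₗ entireSumLin).codRestrict _ fun t => mem_holVField_inter_iff.2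
    ⟨_, contDiffOn_cocycle (contDiff_entireSum t), hasCoords_fieldU _⟩

theorem holCocycle_hasCoords (t : Param) : HasCoords (holCocycle t).1 (cocycle (entireSum t)) :=
  hasCoords_fieldU _

theorem differentiable_of_mem_holFun {b : C3 → ℂ} (hb : b ∈ holFun) :
    Differentiable ℂ fun w => b (0, 0, w) := by
  have := (mem_holFun.1 hb).differentiable (by simp)
  fun_prop

/-- The isomorphism of the space of parameters with `H¹(W₂, TW₂)`: the map `Θ` of the theorem. -/
def theta : Param ≃ₗ[ℂ] H1TW2 :=
  .ofBijective (Submodule.mkQ _ ∘ₗ holCocycle)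
    ⟨isTangentCochains_hol.injective_mkQ_comp le_rfl holCocycle_hasCoords entireSumLin_injective,
      isTangentCochains_hol.surjective_mkQ_comp (ev := entireSumLin) isCoordinateAlgebra_holFun
        holCocycle_hasCoords
        fun _ hb => exists_entireSum_eq (differentiable_of_mem_holFun hb)⟩

theorem mk_eq_theta_iff {θ : holVField (F := C3) (W2U ∩ W2V)} {σ : C3 → C3}
    (hσ : HasCoords θ.1 σ) (t : Param) :
    (Submodule.Quotient.mk θ : H1TW2) = theta t ↔
      ∃ A B : C3 → C3, ContDiff ℂ ω A ∧ ContDiff ℂ ω B ∧ ∀ p : C3, p.1 ≠ 0 →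
        σ p = A p - W2pull p (B (W2trans p)) + cocycle (entireSum t) p := by
  change (Submodule.Quotient.mk θ : H1TW2) = Submodule.Quotient.mk (holCocycle t) ↔ _
  refine (isTangentCochains_hol.mk_eq_mk_iff hσ (holCocycle_hasCoords t)).trans ?_
  simp only [mem_componentsIn_holFun, exists_and_left]

theorem not_finiteDimensional_param : ¬ FiniteDimensional ℂ Param := fun _ =>
  Set.infinite_univ (Set.finite_univ_iff.2 linearIndependent_single.finite)

theorem not_finiteDimensional_H1TW2 : ¬ FiniteDimensional ℂ H1TW2 := fun _ =>
  not_finiteDimensional_param (Module.Finite.equiv theta.symm)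

/-- The polynomial function defined by a polynomial, linearly in the polynomial. -/
def polynomialEval : Polynomial ℂ →ₗ[ℂ] ℂ → ℂ := .pi Polynomial.leval

theorem polynomialEval_injective : Function.Injective polynomialEval :=
  fun _ _ h => Polynomial.funext (congrFun h)

theorem fieldU_cocycle_mem_algUV (T : Polynomial ℂ) :
    fieldU (cocycle (polynomialEval T)) ∈ algUV := by
  have hT : (fun p : C3 => T.eval p.2.2) ∈ polyFun := by
    have : (fun p : C3 => T.eval p.2.2) = Polynomial.aeval (fun p : C3 => p.2.2) T := by
      ext p
      exact (Polynomial.aeval_fn_apply T (fun p : C3 => p.2.2) p).symm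
    rw [this]
    exact Algebra.adjoin_mono (by simp) (Polynomial.aeval_mem_adjoin_singleton ℂ _)
  refine ⟨1, fun p => (0, T.eval p.2.2, 0), ⟨zero_mem _, hT, zero_mem _⟩, ?_⟩
  convert hasCoords_fieldU (cocycle (polynomialEval T)) using 2 with p
  simp [cocycle_apply, polynomialEval]

/-- The vector field `(0, z⁻¹ T(u₂), 0)` for a polynomial `T`, algebraic on `U ∩ V`. -/
def algCocycle : Polynomial ℂ →ₗ[ℂ] algUV :=
  (fieldU ∘ₗ cocycle ∘ₗ polynomialEval).codRestrict _ fieldU_cocycle_mem_algUV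

theorem algCocycle_hasCoords (T : Polynomial ℂ) :
    HasCoords (algCocycle T).1 (cocycle (polynomialEval T)) :=
  hasCoords_fieldU _

/-- The algebraic counterpart of `theta`. -/
def algTheta : Polynomial ℂ ≃ₗ[ℂ] H1TW2alg :=
  .ofBijective (Submodule.mkQ _ ∘ₗ algCocycle)
    ⟨isTangentCochains_alg.injective_mkQ_comp polyFun_le_holFun algCocycle_hasCoords
      polynomialEval_injective,
      isTangentCochains_alg.surjective_mkQ_comp isCoordinateAlgebra_polyFun algCocycle_hasCoords
        fun _ hb => (exists_polynomial_eval_eq hb 0 0).imp fun _ => funext⟩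

theorem exists_algebraic_basis : ∃ b : Module.Basis ℕ ℂ H1TW2alg, ∀ j : ℕ, ∃ θ : algUV,
    HasCoords θ.1 (fun p => (0, p.1⁻¹ * p.2.2 ^ j, 0)) ∧ Submodule.Quotient.mk θ = b j := by
  refine ⟨(Polynomial.basisMonomials ℂ).map algTheta,
    fun j => ⟨algCocycle (Polynomial.monomial j 1), ?_, ?_⟩⟩
  · convert algCocycle_hasCoords (Polynomial.monomial j 1) using 2 with p
    simp [cocycle_apply, polynomialEval]
  · rw [Module.Basis.map_apply, Polynomial.coe_basisMonomials]
    rfl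

end Tot

/-! ### The glued family -/

theorem Glued.t2Space {F : Type*} [TopologicalSpace F] [T2Space F] {g : OpenPartialHomeomorph F F}
    (hg : IsClosed {x : F × F | x.1 ∈ g.source ∧ g x.1 = x.2}) : T2Space (Glued g) := by
  have h_cross : ∀ p q : F, (inU p : Glued g) ≠ inV q →
      ∃ u v : Set (Glued g), IsOpen u ∧ IsOpen v ∧ inU p ∈ u ∧ inV q ∈ v ∧ Disjoint u v := by
    intro p q hpq
    have hn : (p, q) ∈ {x : F × F | x.1 ∈ g.source ∧ g x.1 = x.2}ᶜ := fun h =>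
      hpq (inU_eq_inV_iff.2 h)
    obtain ⟨a, b, ha, hb, hpa, hqb, hab⟩ := isOpen_prod_iff.1 hg.isOpen_compl p q hn
    refine ⟨inU '' a, inV '' b, isOpenEmbedding_inU.isOpenMap a ha,
      isOpenEmbedding_inV.isOpenMap b hb, mem_image_of_mem _ hpa, mem_image_of_mem _ hqb, ?_⟩
    rw [Set.disjoint_left]
    rintro _ ⟨p', hp', rfl⟩ ⟨q', hq', h⟩
    exact hab (mk_mem_prod hp' hq') (inU_eq_inV_iff.1 h.symm)
  have h_same : ∀ {j : F → Glued g}, IsOpenEmbedding j → ∀ p q : F, j p ≠ j q →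
      ∃ u v : Set (Glued g), IsOpen u ∧ IsOpen v ∧ j p ∈ u ∧ j q ∈ v ∧ Disjoint u v := by
    intro j hj p q hpq
    obtain ⟨a, b, ha, hb, hpa, hqb, hab⟩ := t2_separation fun h => hpq (congrArg j h)
    exact ⟨j '' a, j '' b, hj.isOpenMap a ha, hj.isOpenMap b hb, mem_image_of_mem _ hpa,
      mem_image_of_mem _ hqb, (disjoint_image_iff hj.injective).2 hab⟩
  refine ⟨fun x y hxy => ?_⟩
  rcases exists_rep x with ⟨p, rfl⟩ | ⟨p, rfl⟩ <;> rcases exists_rep y with ⟨q, rfl⟩ | ⟨q, rfl⟩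
  · exact h_same isOpenEmbedding_inU p q hxy
  · exact h_cross p q hxy
  · obtain ⟨u, v, hu, hv, hqu, hpv, huv⟩ := h_cross q p hxy.symm
    exact ⟨v, u, hv, hu, hpv, hqu, huv.symm⟩
  · exact h_same isOpenEmbedding_inV p q hxy

theorem isManifold_restrictScalars_real {F : Type*} [NormedAddCommGroup F] [NormedSpace ℂ F]
    [NormedSpace ℝ F] [IsScalarTower ℝ ℂ F] {M : Type*} [TopologicalSpace M] [ChartedSpace F M]
    [IsManifold 𝓘(ℂ, F) ω M] : IsManifold 𝓘(ℝ, F) ω M := by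
  refine isManifold_of_contDiffOn _ _ _ fun e e' he he' => ?_
  have h := contMDiffOn_of_mem_contDiffGroupoid
    (HasGroupoid.compatible (G := contDiffGroupoid ω 𝓘(ℂ, F)) he he')
  simpa using (contMDiffOn_iff_contDiffOn.1 h).restrict_scalars ℝ

section Parametrization

variable {𝕜 : Type*} [NontriviallyNormedField 𝕜]
  {F : Type*} [NormedAddCommGroup F] [NormedSpace 𝕜 F]
  {F' : Type*} [NormedAddCommGroup F'] [NormedSpace 𝕜 F']
  {H' : Type*} [TopologicalSpace H'] {I' : ModelWithCorners 𝕜 F' H'}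
  {N : Type*} [TopologicalSpace N] [ChartedSpace H' N] {n : WithTop ℕ∞}

theorem Glued.contMDiff_iff {g : OpenPartialHomeomorph F F} [IsManifold 𝓘(𝕜, F) ω (Glued g)]
    {f : Glued g → N} :
    ContMDiff 𝓘(𝕜, F) I' n f ↔
      ContMDiff 𝓘(𝕜, F) I' n (f ∘ inU) ∧ ContMDiff 𝓘(𝕜, F) I' n (f ∘ inV) := by
  have hU : IsChartInverse 𝕜 (inU : F → Glued g) _ := isChartInverse_inU
  have hV : IsChartInverse 𝕜 (inV : F → Glued g) _ := isChartInverse_inV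
  rw [← hU.contMDiffOn_range_iff, ← hV.contMDiffOn_range_iff]
  refine ⟨fun h => ⟨h.contMDiffOn, h.contMDiffOn⟩, fun ⟨hfU, hfV⟩ x => ?_⟩
  rcases exists_rep x with ⟨p, rfl⟩ | ⟨p, rfl⟩
  · exact hfU.contMDiffAt (hU.isOpen_range.mem_nhds (mem_range_self p))
  · exact hfV.contMDiffAt (hV.isOpen_range.mem_nhds (mem_range_self p))

theorem IsChartInverse.contMDiffAt_prod {M : Type*} [TopologicalSpace M] [ChartedSpace F M]
    {j : F → M} {e : OpenPartialHomeomorph M F} (h : IsChartInverse 𝕜 j e)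
    {E : Type*} [NormedAddCommGroup E] [NormedSpace 𝕜 E] {f : M × E → N}
    (hf : ContMDiff 𝓘(𝕜, F × E) I' n fun q : F × E => f (j q.1, q.2)) (p : F) (v : E) :
    ContMDiffAt (𝓘(𝕜, F).prod 𝓘(𝕜, E)) I' n f (j p, v) := by
  have h_chart : ContMDiffAt (𝓘(𝕜, F).prod 𝓘(𝕜, E)) 𝓘(𝕜, F × E) n
      (fun x : M × E => (e x.1, x.2)) (j p, v) :=
    (((h.contMDiffAt_chart p).of_le le_top).comp (j p, v) contMDiffAt_fst).prodMk_space
      contMDiffAt_snd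
  refine (hf.contMDiffAt.comp (j p, v) h_chart).congr_of_eventuallyEq ?_
  have : ∀ᶠ x : M × E in 𝓝 (j p, v), x.1 ∈ range j :=
    continuousAt_fst.eventually (h.isOpen_range.mem_nhds (mem_range_self p))
  filter_upwards [this] with x hx
  simp only [Function.comp_apply, h.apply_chart hx]

end Parametrization

instance : IsManifold 𝓘(ℝ, C3) ω (W 2) := isManifold_restrictScalars_real

/-- The function `z̄ / (1 + |z|²)` on `ℂ`. -/
def conjDivOnePlusNormSq (z : ℂ) : ℂ := starRingEnd ℂ z * (1 + starRingEnd ℂ z * z)⁻¹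

theorem one_add_conj_mul_ne_zero (z : ℂ) : 1 + starRingEnd ℂ z * z ≠ 0 := by
  rw [← Complex.normSq_eq_conj_mul_self]
  exact_mod_cast (add_pos_of_pos_of_nonneg one_pos (Complex.normSq_nonneg z)).ne'

theorem contDiff_conjDivOnePlusNormSq : ContDiff ℝ ω conjDivOnePlusNormSq := by
  have h_conj : ContDiff ℝ ω (starRingEnd ℂ) := Complex.conjCLE.contDiff
  exact h_conj.mul ((contDiff_const.add (h_conj.mul contDiff_id)).inv one_add_conj_mul_ne_zero)

-- Divided by `z²`, this exhibits the cocycle `z⁻¹` of `𝒪(-2)` as a smooth coboundary.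
theorem sq_mul_conjDivOnePlusNormSq_add_inv {z : ℂ} (hz : z ≠ 0) :
    z ^ 2 * conjDivOnePlusNormSq z + conjDivOnePlusNormSq z⁻¹ = z := by
  have h := one_add_conj_mul_ne_zero z
  have h' := one_add_conj_mul_ne_zero z⁻¹
  have hz' : starRingEnd ℂ z ≠ 0 := by simpa using hz
  rw [map_inv₀] at h'
  simp only [conjDivOnePlusNormSq, map_inv₀]
  generalize starRingEnd ℂ z = y at h h' hz' ⊢
  have h_inv : y⁻¹ * (1 + y⁻¹ * z⁻¹)⁻¹ = z * (1 + y * z)⁻¹ := by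
    rw [eq_mul_inv_iff_mul_eq₀ h, mul_comm, ← mul_assoc, ← div_eq_mul_inv, div_eq_iff h']
    field_simp
    ring
  rw [h_inv]
  linear_combination mul_inv_cancel_right₀ h z

section Family

variable {E : Type} [NormedAddCommGroup E] [NormedSpace ℂ E] {L : E →ₗ[ℂ] Param}

theorem IsHolParam.contDiff_comp (hL : IsHolParam L) {X : Type*} [NormedAddCommGroup X]
    [NormedSpace ℂ X] {f : X → E} {g : X → ℂ} (hf : ContDiff ℂ ω f) (hg : ContDiff ℂ ω g) :
    ContDiff ℂ ω fun x => entireSum (L (f x)) (g x) :=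
  ContDiff.comp (g := fun q : E × ℂ => entireSum (L q.1) q.2) hL (hf.prodMk hg)

namespace Fam

variable (L) (hL : IsHolParam L)

theorem famTransition_apply (p : C3 × E) : famTransition L hL p =
    ((p.1.1⁻¹, p.1.1 ^ 2 * p.1.2.1 + p.1.1 * entireSum (L p.2) p.1.2.2, p.1.2.2), p.2) := rfl

theorem t2Space : T2Space (Fam L hL) := by
  refine Glued.t2Space ?_
  have h_graph : {x : (C3 × E) × (C3 × E) | x.1 ∈ (famTransition L hL).source ∧
      famTransition L hL x.1 = x.2} = {x | x.2.1.1 * x.1.1.1 = 1} ∩ {x | x.2.1.2.1 =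
        x.1.1.1 ^ 2 * x.1.1.2.1 + x.1.1.1 * entireSum (L x.1.2) x.1.1.2.2} ∩
        {x | x.2.1.2.2 = x.1.1.2.2} ∩ {x | x.2.2 = x.1.2} := by
    ext ⟨⟨⟨z, u, w⟩, e⟩, ⟨⟨z', u', w'⟩, e'⟩⟩
    simp only [famTransition_apply, mem_inter_iff, Set.mem_ofPred_eq, Prod.mk.injEq]
    constructor
    · rintro ⟨hz, ⟨rfl, rfl, rfl⟩, rfl⟩
      exact ⟨⟨⟨inv_mul_cancel₀ hz, rfl⟩, rfl⟩, rfl⟩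
    · rintro ⟨⟨⟨hz, rfl⟩, rfl⟩, rfl⟩
      exact ⟨right_ne_zero_of_mul_eq_one hz, ⟨(eq_inv_of_mul_eq_one_left hz).symm, rfl, rfl⟩, rfl⟩
  rw [h_graph]
  have h_sum : Continuous fun x : (C3 × E) × (C3 × E) => entireSum (L x.1.2) x.1.1.2.2 :=
    (hL.contDiff_comp contDiff_fst.snd contDiff_fst.fst.snd.snd).continuous
  refine (((isClosed_eq ?_ ?_).inter (isClosed_eq ?_ ?_)).inter (isClosed_eq ?_ ?_)).inter
    (isClosed_eq ?_ ?_) <;> fun_prop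

instance : IsManifold 𝓘(ℝ, C3 × E) ω (Fam L hL) := isManifold_restrictScalars_real

/-- The fibrewise translation of `u₁` by `c z̄ / (1 + |z|²) ∑ⱼ tⱼ(e) u₂ʲ`; for `c = 1` on `U` and
`c = -1` on `V` it carries the transition of the family to that of `W₂ × E`. -/
def shift (c : ℂ) (p : C3 × E) : C3 × E :=
  ((p.1.1, p.1.2.1 + c * (conjDivOnePlusNormSq p.1.1 * entireSum (L p.2) p.1.2.2), p.1.2.2), p.2)

include hL in
theorem contDiff_shift (c : ℂ) : ContDiff ℝ ∞ (shift L c) := by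
  have h_sum : ContDiff ℝ ∞ fun p : C3 × E => entireSum (L p.2) p.1.2.2 :=
    ((hL.contDiff_comp contDiff_snd contDiff_fst.snd.snd).restrict_scalars ℝ).of_le le_top
  have h_conj : ContDiff ℝ ∞ fun p : C3 × E => conjDivOnePlusNormSq p.1.1 :=
    (contDiff_conjDivOnePlusNormSq.of_le le_top).comp contDiff_fst.fst
  unfold shift
  fun_prop

theorem shift_neg_shift (c : ℂ) (p : C3 × E) : shift L (-c) (shift L c p) = p := by
  simp [shift]

theorem shift_shift_neg (c : ℂ) (p : C3 × E) : shift L c (shift L (-c) p) = p := by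
  simp [shift]

theorem shift_zero (c : ℂ) (p : C3) : shift L c (p, 0) = (p, 0) := by
  simp [shift, entireSum_zero]

theorem shift_transition {p : C3 × E} (hp : p.1.1 ≠ 0) :
    shift L (-1) (famTransition L hL p) = (W2trans (shift L 1 p).1, p.2) := by
  simp only [famTransition_apply, shift, W2trans, Prod.mk.injEq, and_true, true_and]
  linear_combination (-entireSum (L p.2) p.1.2.2) * sq_mul_conjDivOnePlusNormSq_add_inv hp

/-- The smooth trivialization of the family. -/
def trivMap : Fam L hL → W 2 × E :=
  Glued.lift (fun p => (Tot.inU (shift L 1 p).1, p.2)) (fun q => (Tot.inV (shift L (-1) q).1, q.2))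
    fun p hp => by
      rw [shift_transition L hL hp]
      exact Prod.ext (Tot.inV_W2trans (p := (shift L 1 p).1) hp).symm rfl

/-- The inverse of the smooth trivialization of the family. -/
def trivInv (x : W 2 × E) : Fam L hL :=
  Glued.lift (fun p => (Glued.inU (shift L (-1) (p, x.2)) : Fam L hL))
    (fun q => Glued.inV (shift L 1 (q, x.2))) (fun p hp => by
      refine Glued.inU_eq_inV_iff.2 ⟨hp, ?_⟩
      have h := shift_transition L hL (p := shift L (-1) (p, x.2)) hp
      rw [shift_shift_neg] at h
      rw [← shift_shift_neg L 1 (famTransition L hL _), h, totTransition_W2_apply]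
      rfl) x.1

theorem proj_inU (p : C3 × E) : proj L hL (Glued.inU p) = p.2 := rfl

theorem proj_inV (p : C3 × E) : proj L hL (Glued.inV p) = p.2 := rfl

theorem incl_inU (p : C3) : incl L hL (Tot.inU p) = Glued.inU (p, 0) := rfl

theorem incl_inV (p : C3) : incl L hL (Tot.inV p) = Glued.inV (p, 0) := rfl

theorem contMDiff_trivMap : ContMDiff 𝓘(ℝ, C3 × E) (𝓘(ℝ, C3).prod 𝓘(ℝ, E)) ∞ (trivMap L hL) := by
  have hU : ContMDiff 𝓘(ℝ, C3) 𝓘(ℝ, C3) ∞ Tot.inU :=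
    (Glued.isChartInverse_inU (𝕜 := ℝ)).contMDiff.of_le le_top
  have hV : ContMDiff 𝓘(ℝ, C3) 𝓘(ℝ, C3) ∞ Tot.inV :=
    (Glued.isChartInverse_inV (𝕜 := ℝ)).contMDiff.of_le le_top
  refine Glued.contMDiff_iff.2 ⟨?_, ?_⟩
  · exact (hU.comp (contDiff_shift L hL 1).fst.contMDiff).prodMk contDiff_snd.contMDiff
  · exact (hV.comp (contDiff_shift L hL (-1)).fst.contMDiff).prodMk contDiff_snd.contMDiff

theorem contMDiff_trivInv : ContMDiff (𝓘(ℝ, C3).prod 𝓘(ℝ, E)) 𝓘(ℝ, C3 × E) ∞ (trivInv L hL) := by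
  have hU : ContMDiff 𝓘(ℝ, C3 × E) 𝓘(ℝ, C3 × E) ∞ (Glued.inU : C3 × E → Fam L hL) :=
    (Glued.isChartInverse_inU (𝕜 := ℝ)).contMDiff.of_le le_top
  have hV : ContMDiff 𝓘(ℝ, C3 × E) 𝓘(ℝ, C3 × E) ∞ (Glued.inV : C3 × E → Fam L hL) :=
    (Glued.isChartInverse_inV (𝕜 := ℝ)).contMDiff.of_le le_top
  rintro ⟨x, e⟩
  rcases Glued.exists_rep x with ⟨p, rfl⟩ | ⟨p, rfl⟩
  · exact (Glued.isChartInverse_inU (𝕜 := ℝ)).contMDiffAt_prod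
      (hU.comp (contDiff_shift L hL (-1)).contMDiff) p e
  · exact (Glued.isChartInverse_inV (𝕜 := ℝ)).contMDiffAt_prod
      (hV.comp (contDiff_shift L hL 1).contMDiff) p e

/-- The smooth trivialization of the family as a diffeomorphism. -/
def triv : Diffeomorph 𝓘(ℝ, C3 × E) (𝓘(ℝ, C3).prod 𝓘(ℝ, E)) (Fam L hL) (W 2 × E) ∞ where
  toFun := trivMap L hL
  invFun := trivInv L hL
  left_inv x := by
    rcases Glued.exists_rep x with ⟨p, rfl⟩ | ⟨p, rfl⟩
    · exact congrArg Glued.inU (shift_neg_shift L 1 p)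
    · exact congrArg Glued.inV (shift_shift_neg L 1 p)
  right_inv := by
    rintro ⟨x, e⟩
    rcases Glued.exists_rep x with ⟨p, rfl⟩ | ⟨p, rfl⟩
    · exact congrArg (fun q : C3 × E => (Tot.inU q.1, q.2)) (shift_shift_neg L 1 (p, e))
    · exact congrArg (fun q : C3 × E => (Tot.inV q.1, q.2)) (shift_neg_shift L 1 (p, e))
  contMDiff_toFun := contMDiff_trivMap L hL
  contMDiff_invFun := contMDiff_trivInv L hL

theorem triv_incl (x : W 2) : triv L hL (incl L hL x) = (x, 0) := by
  rcases Glued.exists_rep x with ⟨p, rfl⟩ | ⟨p, rfl⟩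
  · exact congrArg (fun q : C3 × E => (Tot.inU q.1, q.2)) (shift_zero L 1 p)
  · exact congrArg (fun q : C3 × E => (Tot.inV q.1, q.2)) (shift_zero L (-1) p)

theorem triv_snd (m : Fam L hL) : (triv L hL m).2 = proj L hL m := by
  rcases Glued.exists_rep m with ⟨p, rfl⟩ | ⟨p, rfl⟩ <;> rfl

theorem isSubmersionAtOfComplement_proj {j : C3 × E → Fam L hL}
    {k : OpenPartialHomeomorph (Fam L hL) (C3 × E)} (h : IsChartInverse ℂ j k)
    (hj : ∀ p, proj L hL (j p) = p.2) (p : C3 × E) :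
    Manifold.IsSubmersionAtOfComplement C3 𝓘(ℂ, C3 × E) 𝓘(ℂ, E) ω (proj L hL) (j p) := by
  refine .mk_of_charts (ContinuousLinearEquiv.prodComm ℂ C3 E) k (OpenPartialHomeomorph.refl E)
    (h.mem_source p) (mem_univ _) h.mem ?_ (fun _ _ => mem_univ _) fun q _ => ?_
  · exact IsManifold.chart_mem_maximalAtlas (I := 𝓘(ℂ, E)) (0 : E)
  · simp [h.symm_eq, hj]

theorem isSubmersion_proj : Manifold.IsSubmersion 𝓘(ℂ, C3 × E) 𝓘(ℂ, E) ω (proj L hL) := by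
  refine Manifold.IsSubmersionOfComplement.isSubmersion (F := C3) fun x => ?_
  rcases Glued.exists_rep x with ⟨p, rfl⟩ | ⟨p, rfl⟩
  · exact isSubmersionAtOfComplement_proj L hL Glued.isChartInverse_inU (proj_inU L hL) p
  · exact isSubmersionAtOfComplement_proj L hL Glued.isChartInverse_inV (proj_inV L hL) p

theorem isImmersionAtOfComplement_incl {i : C3 → W 2} {d : OpenPartialHomeomorph (W 2) C3}
    {j : C3 × E → Fam L hL} {k : OpenPartialHomeomorph (Fam L hL) (C3 × E)}
    (hd : IsChartInverse ℂ i d) (hk : IsChartInverse ℂ j k)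
    (hi : ∀ p, incl L hL (i p) = j (p, 0)) (p : C3) :
    Manifold.IsImmersionAtOfComplement E 𝓘(ℂ, C3) 𝓘(ℂ, C3 × E) ω (incl L hL) (i p) := by
  refine .mk_of_charts (ContinuousLinearEquiv.refl ℂ (C3 × E)) d k
    (hd.mem_source p) (hi p ▸ hk.mem_source _) hd.mem hk.mem ?_ fun q _ => ?_
  · rw [hd.source]
    rintro _ ⟨q, rfl⟩
    rw [mem_preimage, hi]
    exact hk.mem_source _
  · simp [hd.symm_eq, hi, hk.left_inv]

theorem isImmersion_incl : Manifold.IsImmersion 𝓘(ℂ, C3) 𝓘(ℂ, C3 × E) ω (incl L hL) := by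
  refine Manifold.IsImmersionOfComplement.isImmersion (F := E) fun x => ?_
  rcases Glued.exists_rep x with ⟨p, rfl⟩ | ⟨p, rfl⟩
  · exact isImmersionAtOfComplement_incl L hL Tot.isChartInverse_inU Glued.isChartInverse_inU
      (incl_inU L hL) p
  · exact isImmersionAtOfComplement_incl L hL Tot.isChartInverse_inV Glued.isChartInverse_inV
      (incl_inV L hL) p

theorem isEmbedding_incl : IsEmbedding (incl L hL) := by
  have h : triv L hL ∘ incl L hL = fun x => (x, 0) := funext (triv_incl L hL)
  refine .of_comp (isImmersion_incl L hL).contMDiff.continuous (triv L hL).continuous ?_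
  rw [h]
  exact isEmbedding_prodMkLeft 0

theorem range_incl : range (incl L hL) = proj L hL ⁻¹' {0} := by
  ext m
  constructor
  · rintro ⟨x, rfl⟩
    rcases Glued.exists_rep x with ⟨p, rfl⟩ | ⟨p, rfl⟩ <;> rfl
  · intro hm
    rcases Glued.exists_rep m with ⟨⟨p, e⟩, rfl⟩ | ⟨⟨p, e⟩, rfl⟩
    · obtain rfl : e = 0 := hm
      exact ⟨Tot.inU p, rfl⟩
    · obtain rfl : e = 0 := hm
      exact ⟨Tot.inV p, rfl⟩

theorem isDeformation : IsDeformation (F := C3) (G := C3 × E) (incl L hL) (proj L hL) 0 where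
  hausdorff := t2Space L hL
  submersion := isSubmersion_proj L hL
  surjective e := ⟨Glued.inU (0, e), rfl⟩
  embedding := ⟨isImmersion_incl L hL, isEmbedding_incl L hL⟩
  range_eq := range_incl L hL
  smoothly_trivial := ⟨triv L hL, triv_snd L hL, triv_incl L hL⟩

end Fam

end Family

/-! ### Kodaira–Spencer classes -/

section KodairaSpencer

variable {E : Type} [NormedAddCommGroup E] [NormedSpace ℂ E]

namespace Fam

variable (L : E →ₗ[ℂ] Param) (hL : IsHolParam L)

theorem famTransition_symm_apply (q : C3 × E) : (famTransition L hL).symm q =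
    (W2trans q.1 - (0, q.1.1 * entireSum (L q.2) q.1.2.2, 0), q.2) := by
  simp only [W2trans, Prod.mk_sub_mk, sub_zero]
  rfl

theorem famTransition_zero (p : C3) : famTransition L hL (p, 0) = (W2trans p, 0) := by
  simp [famTransition_apply, W2trans, entireSum_zero]

theorem differentiableAt_famTransition_symm {q : C3 × E} (hq : q.1.1 ≠ 0) :
    DifferentiableAt ℂ (famTransition L hL).symm q := by
  have h_sum : DifferentiableAt ℂ (fun q : C3 × E => entireSum (L q.2) q.1.2.2) q :=
    (hL.contDiff_comp contDiff_snd contDiff_fst.snd.snd).differentiable (by simp) q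
  have : DifferentiableAt ℂ (fun q : C3 × E => q.1.1⁻¹) q :=
    DifferentiableAt.inv (by fun_prop) hq
  change DifferentiableAt ℂ (fun q : C3 × E => ((q.1.1⁻¹,
    q.1.1 ^ 2 * q.1.2.1 - q.1.1 * entireSum (L q.2) q.1.2.2, q.1.2.2), q.2)) q
  fun_prop

theorem hasLineDerivAt_famTransition_symm {p : C3} (hp : p.1 ≠ 0) (v : C3) (e : E) :
    HasLineDerivAt ℂ (famTransition L hL).symm (W2pull p v - cocycle (entireSum (L e)) p, e)
      (W2trans p, 0) (v, e) := by
  have h_line : ∀ s : ℂ, (famTransition L hL).symm ((W2trans p, 0) + s • (v, e)) =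
      ((totTransition (-2) (2 - 2)).symm (W2trans p + s • v) -
        (0, s * ((W2trans p + s • v).1 * entireSum (L e) (W2trans p + s • v).2.2), 0),
        s • e) := fun s => by
    simp only [famTransition_symm_apply, totTransition_W2_symm_apply, Prod.smul_mk,
      Prod.mk_add_mk, zero_add, map_smul, entireSum_smul, mul_left_comm]
  have h_sum : DifferentiableAt ℂ (fun s : ℂ =>
      (W2trans p + s • v).1 * entireSum (L e) (W2trans p + s • v).2.2) 0 := by
    have := (contDiff_entireSum (L e)).differentiable (by simp)
    simp only [Prod.fst_add, Prod.snd_add, Prod.smul_fst, Prod.smul_snd]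
    fun_prop
  have h_mid := (hasDerivAt_id (0 : ℂ)).mul h_sum.hasDerivAt
  have h_tot : HasDerivAt (fun s : ℂ => (totTransition (-2) (2 - 2)).symm (W2trans p + s • v))
      (W2pull p v) 0 := hasLineDerivAt_totTransition_W2_symm hp v
  have h_deriv := (h_tot.sub ((hasDerivAt_const (0 : ℂ) (0 : ℂ)).prodMk
    (h_mid.prodMk (hasDerivAt_const (0 : ℂ) (0 : ℂ))))).prodMk
    ((hasDerivAt_id (0 : ℂ)).smul_const e)
  refine (h_deriv.congr_deriv ?_).congr_of_eventuallyEq (.of_forall h_line)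
  simp [cocycle_apply, W2trans]

theorem mfderiv_inV {p : C3} (hp : p.1 ≠ 0) (v : C3) (e : E) :
    (mfderiv 𝓘(ℂ, C3 × E) 𝓘(ℂ, C3 × E) (Glued.inV : C3 × E → Fam L hL) (W2trans p, 0) (v, e) :
      C3 × E) =
    (mfderiv 𝓘(ℂ, C3 × E) 𝓘(ℂ, C3 × E) (Glued.inU : C3 × E → Fam L hL) (p, 0)
      (W2pull p v - cocycle (entireSum (L e)) p, e) : C3 × E) := by
  have hd := differentiableAt_famTransition_symm L hL (q := (W2trans p, 0)) (inv_ne_zero hp)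
  have h := hasLineDerivAt_famTransition_symm L hL hp v e
  rw [← famTransition_zero L hL] at hd h ⊢
  exact Glued.mfderiv_inV hp hd h

theorem contMDiff_proj : ContMDiff 𝓘(ℂ, C3 × E) 𝓘(ℂ, E) ω (proj L hL) :=
  (isSubmersion_proj L hL).contMDiff

theorem contMDiff_incl : ContMDiff 𝓘(ℂ, C3) 𝓘(ℂ, C3 × E) ω (incl L hL) :=
  (isImmersion_incl L hL).contMDiff

section Parametrization

variable {i : C3 → W 2} {d : OpenPartialHomeomorph (W 2) C3} (hd : IsChartInverse ℂ i d)
  {j : C3 × E → Fam L hL} {k : OpenPartialHomeomorph (Fam L hL) (C3 × E)}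
  (hk : IsChartInverse ℂ j k)
include hd in
theorem isLift_iff_comp (hi : ∀ p, incl L hL (i p) = j (p, 0)) {e : E}
    {a : (x : W 2) → TangentSpace 𝓘(ℂ, C3 × E) (incl L hL x)} :
    IsLift (F := C3) (incl L hL) (proj L hL) (range i) e a ↔
      ContMDiff 𝓘(ℂ, C3) 𝓘(ℂ, C3 × E).tangent ω (fun p : C3 =>
        (⟨j (p, 0), (a (i p) : C3 × E)⟩ : TangentBundle 𝓘(ℂ, C3 × E) (Fam L hL))) ∧
      ∀ p, (mfderiv 𝓘(ℂ, C3 × E) 𝓘(ℂ, E) (proj L hL) (j (p, 0)) (a (i p) : C3 × E) : E) = e := by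
  have h_bundle : (fun p : C3 => (⟨j (p, 0), (a (i p) : C3 × E)⟩ :
      TangentBundle 𝓘(ℂ, C3 × E) (Fam L hL))) =
      (fun x => (⟨incl L hL x, a x⟩ : TangentBundle 𝓘(ℂ, C3 × E) (Fam L hL))) ∘ i :=
    funext fun p => congrArg (fun y => (⟨y, (a (i p) : C3 × E)⟩ :
      TangentBundle 𝓘(ℂ, C3 × E) (Fam L hL))) (hi p).symm
  have h_mfderiv : ∀ p, (mfderiv 𝓘(ℂ, C3 × E) 𝓘(ℂ, E) (proj L hL) (j (p, 0))
      (a (i p) : C3 × E) : E) =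
      (mfderiv 𝓘(ℂ, C3 × E) 𝓘(ℂ, E) (proj L hL) (incl L hL (i p)) (a (i p)) : E) := fun p =>
    congrArg (fun y => (mfderiv 𝓘(ℂ, C3 × E) 𝓘(ℂ, E) (proj L hL) y (a (i p) : C3 × E) : E))
      (hi p).symm
  rw [h_bundle, ← hd.contMDiffOn_range_iff]
  simp only [h_mfderiv]
  exact ⟨fun h => ⟨h.holomorphic, fun p => h.lift _ (mem_range_self p)⟩,
    fun h => ⟨h.1, forall_mem_range.2 h.2⟩⟩

include hk

theorem mfderiv_proj (hj : ∀ p, proj L hL (j p) = p.2) (p v : C3 × E) :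
    (mfderiv 𝓘(ℂ, C3 × E) 𝓘(ℂ, E) (proj L hL) (j p)
      (mfderiv 𝓘(ℂ, C3 × E) 𝓘(ℂ, C3 × E) j p v) : E) = v.2 := by
  have h_chain := mfderiv_comp p ((contMDiff_proj L hL).mdifferentiable (by simp) (j p))
    (hk.mdifferentiableAt p)
  have h_comp : proj L hL ∘ j = Prod.snd := funext hj
  rw [h_comp, mfderiv_eq_fderiv, fderiv_snd] at h_chain
  exact (congrArg (fun T : C3 × E →L[ℂ] E => T v) h_chain).symm

theorem snd_mfderiv_chart (hj : ∀ p, proj L hL (j p) = p.2) (p : C3 × E)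
    (v : TangentSpace 𝓘(ℂ, C3 × E) (j p)) :
    (mfderiv 𝓘(ℂ, C3 × E) 𝓘(ℂ, C3 × E) k (j p) v : C3 × E).2 =
      (mfderiv 𝓘(ℂ, C3 × E) 𝓘(ℂ, E) (proj L hL) (j p) v : E) := by
  have h := mfderiv_proj L hL hk hj p
    (mfderiv 𝓘(ℂ, C3 × E) 𝓘(ℂ, C3 × E) k (j p) v : C3 × E)
  exact h.symm.trans (congrArg
    (fun w : C3 × E => (mfderiv 𝓘(ℂ, C3 × E) 𝓘(ℂ, E) (proj L hL) (j p) w : E))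
    (hk.mfderiv_apply_chart p v))

include hd in
theorem mfderiv_incl (hi : ∀ p, incl L hL (i p) = j (p, 0)) (p v : C3) :
    (mfderiv 𝓘(ℂ, C3) 𝓘(ℂ, C3 × E) (incl L hL) (i p)
      (mfderiv 𝓘(ℂ, C3) 𝓘(ℂ, C3) i p v) : C3 × E) =
      (mfderiv 𝓘(ℂ, C3 × E) 𝓘(ℂ, C3 × E) j (p, 0) (v, 0) : C3 × E) := by
  have h_inl : HasFDerivAt (fun q : C3 => (q, (0 : E))) (ContinuousLinearMap.inl ℂ C3 E) p :=
    (ContinuousLinearMap.inl ℂ C3 E).hasFDerivAt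
  have h_incl := mfderiv_comp p ((contMDiff_incl L hL).mdifferentiable (by simp) (i p))
    (hd.mdifferentiableAt p)
  have h_chart := mfderiv_comp p (hk.mdifferentiableAt (p, 0))
    h_inl.differentiableAt.mdifferentiableAt
  have h_comp : incl L hL ∘ i = j ∘ fun q => (q, 0) := funext hi
  rw [h_comp, h_chart, mfderiv_eq_fderiv, h_inl.fderiv] at h_incl
  exact (congrArg (fun T : C3 →L[ℂ] C3 × E => T v) h_incl).symm

include hd in
theorem isLift_iff (hi : ∀ p, incl L hL (i p) = j (p, 0)) (hj : ∀ p, proj L hL (j p) = p.2)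
    {e : E} {a : (x : W 2) → TangentSpace 𝓘(ℂ, C3 × E) (incl L hL x)} :
    IsLift (F := C3) (incl L hL) (proj L hL) (range i) e a ↔ ∃ α : C3 → C3, ContDiff ℂ ω α ∧
      ∀ p, (a (i p) : C3 × E) =
        (mfderiv 𝓘(ℂ, C3 × E) 𝓘(ℂ, C3 × E) j (p, 0) (α p, e) : C3 × E) := by
  rw [isLift_iff_comp L hL hd hi]
  constructor
  · rintro ⟨h_hol, h_lift⟩
    have h_comp := hk.contDiffOn_components (s := univ) (c := fun p : C3 => (p, (0 : E)))
      (a := fun p => (a (i p) : C3 × E)) h_hol.contMDiffOn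
    refine ⟨_, (contDiffOn_univ.1 h_comp).fst, fun p => ?_⟩
    refine (hk.mfderiv_apply_chart (p, 0) (a (i p) : C3 × E)).symm.trans ?_
    have h_snd := (snd_mfderiv_chart L hL hk hj (p, 0) (a (i p) : C3 × E)).trans (h_lift p)
    exact congrArg (fun v : C3 × E => (mfderiv 𝓘(ℂ, C3 × E) 𝓘(ℂ, C3 × E) j (p, 0) v : C3 × E))
      (Prod.ext rfl h_snd)
  · rintro ⟨α, hα, ha⟩
    simp only [ha]
    refine ⟨contMDiffOn_univ.1 ?_, fun p => mfderiv_proj L hL hk hj (p, 0) (α p, e)⟩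
    exact hk.contMDiffOn_of_components (s := univ) (c := fun p : C3 => (p, (0 : E)))
      (α := fun p => (α p, e)) (by fun_prop) (by fun_prop)

include hd in
theorem exists_isLift (hi : ∀ p, incl L hL (i p) = j (p, 0)) (hj : ∀ p, proj L hL (j p) = p.2)
    (e : E) {α : C3 → C3} (hα : ContDiff ℂ ω α) :
    ∃ a : (x : W 2) → TangentSpace 𝓘(ℂ, C3 × E) (incl L hL x),
      IsLift (F := C3) (incl L hL) (proj L hL) (range i) e a ∧ ∀ p, (a (i p) : C3 × E) =
        (mfderiv 𝓘(ℂ, C3 × E) 𝓘(ℂ, C3 × E) j (p, 0) (α p, e) : C3 × E) := by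
  let a : (x : W 2) → TangentSpace 𝓘(ℂ, C3 × E) (incl L hL x) := fun x =>
    (mfderiv 𝓘(ℂ, C3 × E) 𝓘(ℂ, C3 × E) j (d x, 0) (α (d x), e) : C3 × E)
  have ha : ∀ p, (a (i p) : C3 × E) =
      (mfderiv 𝓘(ℂ, C3 × E) 𝓘(ℂ, C3 × E) j (p, 0) (α p, e) : C3 × E) := fun p =>
    congrArg (fun q : C3 => (mfderiv 𝓘(ℂ, C3 × E) 𝓘(ℂ, C3 × E) j (q, 0) (α q, e) : C3 × E))
      (hd.left_inv p)
  exact ⟨a, (isLift_iff L hL hd hk hi hj).2 ⟨α, hα, ha⟩, ha⟩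

end Parametrization

theorem mfderiv_incl_eq_sub_iff {α β : C3 → C3} {e : E} {p : C3} (hp : p.1 ≠ 0) {v : C3}
    {a b : (x : W 2) → TangentSpace 𝓘(ℂ, C3 × E) (incl L hL x)}
    (ha : ∀ p, (a (Tot.inU p) : C3 × E) = (mfderiv 𝓘(ℂ, C3 × E) 𝓘(ℂ, C3 × E)
      (Glued.inU : C3 × E → Fam L hL) (p, 0) (α p, e) : C3 × E))
    (hb : ∀ p, (b (Tot.inV p) : C3 × E) = (mfderiv 𝓘(ℂ, C3 × E) 𝓘(ℂ, C3 × E)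
      (Glued.inV : C3 × E → Fam L hL) (p, 0) (β p, e) : C3 × E)) :
    mfderiv 𝓘(ℂ, C3) 𝓘(ℂ, C3 × E) (incl L hL) (Tot.inU p)
        (mfderiv 𝓘(ℂ, C3) 𝓘(ℂ, C3) Tot.inU p v) = a (Tot.inU p) - b (Tot.inU p) ↔
      v = α p - W2pull p (β (W2trans p)) + cocycle (entireSum (L e)) p := by
  let D : C3 × E →L[ℂ] C3 × E := mfderiv 𝓘(ℂ, C3 × E) 𝓘(ℂ, C3 × E)
    (Glued.inU : C3 × E → Fam L hL) (p, 0)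
  have hD : Function.Injective D :=
    (Glued.isChartInverse_inU (𝕜 := ℂ) (g := famTransition L hL)).mfderiv_injective (p, 0)
  have hv : (mfderiv 𝓘(ℂ, C3) 𝓘(ℂ, C3 × E) (incl L hL) (Tot.inU p)
      (mfderiv 𝓘(ℂ, C3) 𝓘(ℂ, C3) Tot.inU p v) : C3 × E) = D (v, 0) :=
    mfderiv_incl L hL Tot.isChartInverse_inU Glued.isChartInverse_inU (incl_inU L hL) p v
  have hb' : (b (Tot.inU p) : C3 × E) =
      D (W2pull p (β (W2trans p)) - cocycle (entireSum (L e)) p, e) := by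
    have h : (b (Tot.inV (W2trans p)) : C3 × E) = b (Tot.inU p) :=
      congrArg (fun x => (b x : C3 × E)) (Tot.inV_W2trans hp)
    rw [← h, hb]
    exact mfderiv_inV L hL hp _ e
  have ha' : (a (Tot.inU p) : C3 × E) = D (α p, e) := ha p
  have h_sub : ∀ x y : C3, D (v, 0) = D (x, e) - D (y, e) ↔ v = x - y := fun x y => by
    rw [← map_sub, hD.eq_iff, Prod.mk_sub_mk, sub_self, Prod.mk.injEq, and_iff_left rfl]
  change (mfderiv 𝓘(ℂ, C3) 𝓘(ℂ, C3 × E) (incl L hL) (Tot.inU p)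
      (mfderiv 𝓘(ℂ, C3) 𝓘(ℂ, C3) Tot.inU p v) : C3 × E) =
    (a (Tot.inU p) : C3 × E) - (b (Tot.inU p) : C3 × E) ↔ _
  rw [hv, ha', hb']
  refine (h_sub _ _).trans ?_
  rw [sub_sub_eq_add_sub, add_sub_right_comm]

theorem isKodairaSpencerClass_iff (e : E) (c : H1TW2) :
    IsKodairaSpencerClass (F := C3) (G := C3 × E) (incl L hL) (proj L hL) W2U W2V e c ↔
      c = Tot.theta (L e) := by
  constructor
  · rintro ⟨θ, rfl, a, b, ha, hb, h⟩
    obtain ⟨α, hα, ha⟩ := (isLift_iff L hL Tot.isChartInverse_inU Glued.isChartInverse_inU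
      (incl_inU L hL) (proj_inU L hL)).1 ha
    obtain ⟨β, hβ, hb⟩ := (isLift_iff L hL Tot.isChartInverse_inV Glued.isChartInverse_inV
      (incl_inV L hL) (proj_inV L hL)).1 hb
    obtain ⟨σ, _, hσ⟩ := Tot.mem_holVField_inter_iff.1 θ.2
    refine (Tot.mk_eq_theta_iff hσ _).2 ⟨α, β, hα, hβ, fun p hp => ?_⟩
    have h_diff := h _ (Tot.inU_mem_inter hp)
    rw [hσ p hp] at h_diff
    exact (mfderiv_incl_eq_sub_iff L hL hp ha hb).1 h_diff
  · rintro rfl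
    obtain ⟨a, ha, ha'⟩ := exists_isLift L hL Tot.isChartInverse_inU Glued.isChartInverse_inU
      (incl_inU L hL) (proj_inU L hL) e (α := 0) contDiff_const
    obtain ⟨b, hb, hb'⟩ := exists_isLift L hL Tot.isChartInverse_inV Glued.isChartInverse_inV
      (incl_inV L hL) (proj_inV L hL) e (α := 0) contDiff_const
    refine ⟨Tot.holCocycle (L e), rfl, a, b, ha, hb, fun x hx => ?_⟩
    obtain ⟨p, hp, rfl⟩ := Tot.W2U_inter_W2V.subset hx
    rw [Tot.holCocycle_hasCoords (L e) p hp]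
    refine (mfderiv_incl_eq_sub_iff L hL hp ha' hb').2 ?_
    simp [W2pull]

end Fam

end KodairaSpencer

/-! ### Parameter spaces -/

open scoped BoundedContinuousFunction

theorem isHolParam_of_finiteDimensional {E : Type} [NormedAddCommGroup E] [NormedSpace ℂ E]
    [FiniteDimensional ℂ E] (L : E →ₗ[ℂ] Param) : IsHolParam L := by
  let b := Module.finBasis ℂ E
  have h : ∀ (e : E) (w : ℂ), entireSum (L e) w = ∑ i, b.repr e i * entireSum (L (b i)) w := by
    intro e w
    change entireSumLin (L e) w = _
    conv_lhs => rw [← b.sum_repr e]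
    simp only [map_sum, map_smul, Finset.sum_apply, Pi.smul_apply, smul_eq_mul]
    rfl
  have h_prod : (fun q : E × ℂ => entireSum (L q.1) q.2) =
      fun q => ∑ i, b.repr q.1 i * entireSum (L (b i)) q.2 := funext fun q => h q.1 q.2
  rw [IsHolParam, h_prod]
  refine ContDiff.sum fun i _ => ContDiff.mul ?_ ((contDiff_entireSum _).comp contDiff_snd)
  exact (LinearMap.toContinuousLinearMap (b.coord i)).contDiff.comp contDiff_fst

/-- The left shift on bounded sequences. -/
def leftShift : (ℕ →ᵇ ℂ) →L[ℂ] (ℕ →ᵇ ℂ) :=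
  BoundedContinuousFunction.compContinuousCLM ℂ ℂ ⟨Nat.succ, continuous_of_discreteTopology⟩

theorem smul_leftShift_pow_apply (w : ℂ) (n : ℕ) (x : ℕ →ᵇ ℂ) (k : ℕ) :
    ((w • leftShift) ^ n) x k = w ^ n * x (k + n) := by
  induction n generalizing k with
  | zero => simp
  | succ n ih =>
    rw [pow_succ']
    change w * ((w • leftShift) ^ n) x (k + 1) = _
    rw [ih, pow_succ', mul_assoc, add_assoc, add_comm 1 n]

theorem hasSum_exp_leftShift (x : ℕ →ᵇ ℂ) (w : ℂ) :
    HasSum (fun n : ℕ => ((n.factorial : ℂ)⁻¹ * x n) * w ^ n)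
      (NormedSpace.exp (w • leftShift) x 0) := by
  have h_exp := (NormedSpace.exp_series_hasSum_exp' (𝕂 := ℂ) (w • leftShift)).mapL
    ((BoundedContinuousFunction.evalCLM ℂ 0).comp (ContinuousLinearMap.apply ℂ (ℕ →ᵇ ℂ) x))
  refine h_exp.congr_fun fun n => ?_
  change _ = (n.factorial : ℂ)⁻¹ * ((w • leftShift) ^ n) x 0
  rw [smul_leftShift_pow_apply, zero_add]
  ring

/-- Bounded sequences `x` as parameters `tⱼ = xⱼ / j!`. -/
def boundedParam : (ℕ →ᵇ ℂ) →ₗ[ℂ] Param where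
  toFun x := ⟨fun n => (n.factorial : ℂ)⁻¹ * x n, fun w => (hasSum_exp_leftShift x w).summable⟩
  map_add' _ _ := Subtype.ext (funext fun _ => mul_add _ _ _)
  map_smul' _ _ := Subtype.ext (funext fun _ => mul_left_comm _ _ _)

theorem isHolParam_boundedParam : IsHolParam boundedParam := by
  have h : ∀ q : (ℕ →ᵇ ℂ) × ℂ, entireSum (boundedParam q.1) q.2 =
      BoundedContinuousFunction.evalCLM ℂ 0 (NormedSpace.exp (q.2 • leftShift) q.1) := fun q =>
    (hasSum_exp_leftShift q.1 q.2).tsum_eq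
  have h_exp : ContDiff ℂ ω (NormedSpace.exp : ((ℕ →ᵇ ℂ) →L[ℂ] (ℕ →ᵇ ℂ)) → _) := by
    rw [← contDiffOn_univ]
    exact AnalyticOnNhd.contDiffOn (fun T _ => NormedSpace.exp_analytic T) uniqueDiffOn_univ
  unfold IsHolParam
  simp only [h]
  refine (ContinuousLinearMap.contDiff _).comp (ContDiff.clm_apply (h_exp.comp ?_) contDiff_fst)
  exact contDiff_snd.smul contDiff_const

theorem boundedParam_injective : Function.Injective boundedParam := by
  intro x y h
  ext n
  have h_term : (n.factorial : ℂ)⁻¹ * x n = (n.factorial : ℂ)⁻¹ * y n :=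
    congrFun (congrArg Subtype.val h) n
  exact mul_left_cancel₀ (inv_ne_zero (by exact_mod_cast n.factorial_ne_zero)) h_term

theorem single_mem_range_boundedParam (j : ℕ) :
    Param.single j ∈ LinearMap.range boundedParam := by
  refine ⟨BoundedContinuousFunction.ofNormedAddCommGroupDiscrete
    (Pi.single j (j.factorial : ℂ)) (j.factorial : ℝ) fun n => ?_, ?_⟩
  · rcases eq_or_ne n j with rfl | h
    · simp
    · simp [Pi.single_eq_of_ne h]
  · refine Subtype.ext (funext fun n => ?_)
    change (n.factorial : ℂ)⁻¹ * Pi.single (M := fun _ => ℂ) j (j.factorial : ℂ) n =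
      Pi.single (M := fun _ => ℂ) j 1 n
    rcases eq_or_ne n j with rfl | h
    · simp [n.factorial_ne_zero]
    · simp [Pi.single_eq_of_ne h]

theorem not_finiteDimensional_bounded : ¬ FiniteDimensional ℂ (ℕ →ᵇ ℂ) := fun _ => by
  choose f hf using single_mem_range_boundedParam
  have h : LinearIndependent ℂ f := LinearIndependent.of_comp boundedParam <| by
    rw [show boundedParam ∘ f = Param.single from funext hf]
    exact linearIndependent_single
  exact Set.infinite_univ (Set.finite_univ_iff.2 h.finite)

theorem Fam.inU_eq_inV_iff {E : Type} [NormedAddCommGroup E] [NormedSpace ℂ E]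
    (L : E →ₗ[ℂ] Param) (hL : IsHolParam L) (z u₁ u₂ ξ v₁ v₂ : ℂ) (e e' : E) :
    (Glued.inU ((z, u₁, u₂), e) : Fam L hL) = Glued.inV ((ξ, v₁, v₂), e') ↔
      z ≠ 0 ∧ ξ = z⁻¹ ∧ v₁ = z ^ 2 * u₁ + ∑' j : ℕ, (L e).1 j * z * u₂ ^ j ∧ v₂ = u₂ ∧ e' = e := by
  have h : ∑' j : ℕ, (L e).1 j * z * u₂ ^ j = z * entireSum (L e) u₂ := by
    rw [entireSum, ← tsum_mul_left]
    exact tsum_congr fun j => by ring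
  rw [Glued.inU_eq_inV_iff, h, Fam.famTransition_apply]
  simp only [Prod.mk.injEq, and_assoc]
  exact and_congr_right fun _ => by simp only [eq_comm]

theorem mainTheorem4 :
    -- `H¹(W₂, TW₂)`, holomorphic: every class has a unique representative
    -- `(0, z⁻¹ ∑ⱼ tⱼ u₂ʲ, 0)` with `∑ⱼ tⱼ wʲ` entire, and `Θ` is this parametrization.
    (∃ Θ : Param ≃ₗ[ℂ] H1TW2,
      (∀ t : Param, ∃ θ : holVField (F := C3) (W2U ∩ W2V),
        HasCoords θ.1 (fun p => (0, p.1⁻¹ * entireSum t p.2.2, 0)) ∧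
        Submodule.Quotient.mk θ = Θ t) ∧
      -- The explicit family is a deformation of `W₂`, with the cocycles as Kodaira–Spencer classes.
      (∀ (E : Type) [NormedAddCommGroup E] [NormedSpace ℂ E] (L : E →ₗ[ℂ] Param)
        (hL : IsHolParam L),
        IsDeformation (F := C3) (G := C3 × E) (Fam.incl L hL) (Fam.proj L hL) 0 ∧
        ∀ (e : E) (c : H1TW2),
          IsKodairaSpencerClass (F := C3) (G := C3 × E) (Fam.incl L hL) (Fam.proj L hL)
            W2U W2V e c ↔ c = Θ (L e))) ∧
    ¬ FiniteDimensional ℂ H1TW2 ∧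
    -- `H¹(W₂, TW₂)`, algebraic: the cocycles `(0, z⁻¹ u₂ʲ, 0)` represent a vector space basis.
    (∃ b : Module.Basis ℕ ℂ H1TW2alg, ∀ j : ℕ, ∃ θ : algUV,
      HasCoords θ.1 (fun p => (0, p.1⁻¹ * p.2.2 ^ j, 0)) ∧ Submodule.Quotient.mk θ = b j) ∧
    -- All classes integrate.
    (∀ c : H1TW2, ∃ (L : ℂ →ₗ[ℂ] Param) (hL : IsHolParam L),
      IsDeformation (F := C3) (G := C3 × ℂ) (Fam.incl L hL) (Fam.proj L hL) 0 ∧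
      IsKodairaSpencerClass (F := C3) (G := C3 × ℂ) (Fam.incl L hL) (Fam.proj L hL)
        W2U W2V (1 : ℂ) c) ∧
    -- The family is holomorphic over every finite-dimensional space of parameters.
    (∀ (E : Type) [NormedAddCommGroup E] [NormedSpace ℂ E] [FiniteDimensional ℂ E]
      (L : E →ₗ[ℂ] Param), IsHolParam L) ∧
    -- It is holomorphic over some infinite-dimensional Banach space of parameters that contains
    -- all finite sequences `(t₀, t₁, …)`.
    (∃ (E : Type) (_ : NormedAddCommGroup E) (_ : NormedSpace ℂ E) (_ : CompleteSpace E)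
      (L : E →ₗ[ℂ] Param), IsHolParam L ∧ ¬ FiniteDimensional ℂ E ∧ Function.Injective L ∧
      ∀ j : ℕ, Param.single j ∈ LinearMap.range L) ∧
    -- The transition of the family.
    (∀ (E : Type) [NormedAddCommGroup E] [NormedSpace ℂ E] (L : E →ₗ[ℂ] Param)
      (hL : IsHolParam L) (z u₁ u₂ ξ v₁ v₂ : ℂ) (e e' : E),
      (Glued.inU ((z, u₁, u₂), e) : Fam L hL) = Glued.inV ((ξ, v₁, v₂), e') ↔
        z ≠ 0 ∧ ξ = z⁻¹ ∧ v₁ = z ^ 2 * u₁ + ∑' j : ℕ, (L e).1 j * z * u₂ ^ j ∧ v₂ = u₂ ∧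
          e' = e) := by
  refine ⟨⟨Tot.theta, fun t => ⟨Tot.holCocycle t, Tot.holCocycle_hasCoords t, rfl⟩,
    fun E _ _ L hL => ⟨Fam.isDeformation L hL, Fam.isKodairaSpencerClass_iff L hL⟩⟩,
    Tot.not_finiteDimensional_H1TW2, Tot.exists_algebraic_basis, fun c => ?_,
    fun E _ _ _ L => isHolParam_of_finiteDimensional L, ?_,
    fun E _ _ L hL => Fam.inU_eq_inV_iff L hL⟩
  · let L : ℂ →ₗ[ℂ] Param := LinearMap.toSpanSingleton ℂ Param (Tot.theta.symm c)
    have hL := isHolParam_of_finiteDimensional L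
    refine ⟨L, hL, Fam.isDeformation L hL, (Fam.isKodairaSpencerClass_iff L hL 1 c).2 ?_⟩
    simp [L]
  · exact ⟨ℕ →ᵇ ℂ, inferInstance, inferInstance, inferInstance, boundedParam,
      isHolParam_boundedParam, not_finiteDimensional_bounded, boundedParam_injective,
      single_mem_range_boundedParam⟩
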